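/- \textbf{Theorem (Second Euler--Savary equation).} Let $(X,\|\cdot\|)$ be a normed plane (a two-dimensional real normed space) with a fixed Cartesian coordinate system, which provides an auxiliary Euclidean norm $\|\cdot\|_E$, Euclidean area, length, angle and orientation. Let $B$ be the unit disc of $\|\cdot\|$ and suppose that the unit circle $\partial B$ is a regular curve of class $C^2$. \emph{Notation.} For a line $t$ let $\sigma(t)=2/\mathrm{length}_E(B\cap t_0)$, where $t_0$ is the parallel of $t$ through $0$; for the whole plane $T$ let $\sigma(T)=\pi/\mathrm{area}_E(B)$. Busemann area is $\sigma(T)$ times Euclidean area, and $\mathrm{sm}(a,b)$ is the Busemann area of a parallelogram spanned by segments on the lines $a,b$, divided by the product of the $\|\cdot\|$-lengths of the two segments. The (absolute) Busemann curvature of a curve $c$ at $c(s)$ is $$2\lim_{s_0,s_1,s_2\to s}\frac{\mathrm{sm}\big(g(c(s_0),c(s_1)),\,g(c(s_1),c(s_2))\big)}{\|c(s_2)-c(s_0)\|}\qquad(s_0,s_1,s_2\text{ pairwise distinct}),$$ where $g(p,q)$ is the line through $p$ and $q$; if $c$ is traversed in a given direction, the curvature is counted with sign, positive for left turns (the limit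 over $s_0,s_1,s_2$ in the order of traversal, each quotient being multiplied by the orientation sign of the triangle $c(s_0)c(s_1)c(s_2)$). The curvature radius is $r=1/\chi$, with $1/r=0$ when $\chi=0$. For $\varphi\in\mathbb R$ let $\mathrm R(\varphi):X\to X$ be the arc-length general rotation about $0$: it preserves $\|\cdot\|$, commutes with positive dilatations, and moves every point of $\partial B$ counterclockwise along $\partial B$ by an arc whose $\|\cdot\|$-length is the fraction $\varphi/2\pi$ of the total length of $\partial B$. \emph{Rolling.} Let $\beta>0$ and let $\gamma$ (the fixed polode) and $\gamma'$ (the moving polode) be curves $[0,\beta]\to X$ of class $C^2$, both parametrized by $\|\cdot\|$-arc-length, with $\gamma(0)=\gamma'(0)$ and with the same unit tangent vector there; $\gamma'$ rolls without slipping on $\gamma$. The corresponding flexible motion is $$\Phi_s(p)=\gamma(s)+\mathrm R(\varphi_s)\,(p-\gamma'(s)),\qquad s\in[0,\beta],$$ where $\mathrm R(\varphi_s)$ takes the direction $\dot\gamma'(s)$ to the direction $\dot\gamma(s)$. At the moment $s$ the moving polode occupies the position $\gamma'_s=\Phi_s\circ\gamma'$ (so that $\gamma'_0=\gamma'$). Fix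 $s\in[0,\beta]$ and let $\omega(t)$ be the directed Euclidean angle from $\dot\gamma(s)$ to $\mathrm R(\varphi_t-\varphi_s)\dot\gamma(s)$, for $t$ near $s$. Suppose that the motion is not translatory at the moment $s$, i.e. $\dot\omega(s)=\frac{d\omega}{dt}(s)\neq0$ (one-sided derivatives are meant throughout if $s\in\{0,\beta\}$). The velocity vector of a polode is its derivative with respect to the rotation angle $\omega$, that is, its derivative with respect to the parameter divided by $\dot\omega(s)$. \emph{Claim.} The polodes $\gamma$ and $\gamma'_s$ pass through the common point $K=\gamma(s)=\gamma'_s(s)$ and have a common velocity vector there, hence a common tangent line $t_K$. Both have a Busemann curvature at $K$. If $\chi_\gamma,\chi_{\gamma'}$ are these curvatures counted with sign, both polodes being traversed in the direction of their common velocity vector (the direction in which $\omega$ increases), and if $r_\gamma,r_{\gamma'}$ are the corresponding curvature radii, then their absolute values are the absolute Busemann curvatures, and $$\chi_\gamma-\chi_{\gamma'}=\frac1{r_\gamma}-\frac1{r_{\gamma'}}=\frac{\sigma(T_K)}{\sigma^2(t_K)}\,\frac1{\alpha_K},$$ where $T_K=T$ is the osculating plane and $\alpha_K$ is the $\|\cdot\|$-length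 of the common velocity vector at $K$. -/

import Mathlib

open Set Filter Topology MeasureTheory

namespace NormedPlane

noncomputable section

/-- The unit circle of `X` is a regular curve of class `C^2`. -/
def UnitCircleC2 (X : Type*) [NormedAddCommGroup X] [NormedSpace ℝ X] : Prop :=
  ∃ c : ℝ → X, ContDiff ℝ 2 c ∧ (∀ t, deriv c t ≠ 0) ∧ range c = Metric.sphere (0 : X) 1

/-! Throughout, `X` is a normed plane, and `e : X ≃L[ℝ] ℂ` is a Cartesian coordinate system; it
carries the auxiliary Euclidean metric, area, angle and (counterclockwise) orientation. -/

variable {X : Type*} [NormedAddCommGroup X] [NormedSpace ℝ X] (e : X ≃L[ℝ] ℂ)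

/-! ### The sigma function, Busemann area and the Minkowskian sine -/

/-- The sigma function of a line with direction `v`: the length `2` of the one-dimensional unit
ball over the Euclidean length of the part of the unit disc on the parallel line through `0`. -/
def sigmaLine (v : X) : ℝ :=
  2 / (Measure.hausdorffMeasure 1
    (e '' {x : X | x ∈ Submodule.span ℝ {v} ∧ ‖x‖ ≤ 1})).toReal

/-- The sigma function of the whole plane: the area `π` of the two-dimensional Euclidean unit
ball over the Euclidean area of the unit disc of the norm. -/
def sigmaPlane : ℝ :=
  Real.pi / (volume (e '' Metric.closedBall (0 : X) 1)).toReal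

/-- Busemann area: the multiple of Euclidean area that gives the unit disc of the norm area `π`. -/
def busemannArea (A : Set X) : ℝ :=
  sigmaPlane e * (volume (e '' A)).toReal

/-- The sine function of Busemann of the two lines that carry the segments `u` and `v`. -/
def busemannSine (u v : X) : ℝ :=
  busemannArea e (parallelepiped ![u, v]) / (‖u‖ * ‖v‖)

/-! ### Busemann curvature -/

/-- The quotient `2 sm(g(p₀,p₁), g(p₁,p₂)) / ‖p₂ - p₀‖`. -/
def curvatureQuotient (p₀ p₁ p₂ : X) : ℝ :=
  2 * busemannSine e (p₁ - p₀) (p₂ - p₁) / ‖p₂ - p₀‖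

/-- `χ` is the (absolute) Busemann curvature at parameter `s` of the curve `c`, defined on `I`. -/
def HasBusemannCurvature (c : ℝ → X) (I : Set ℝ) (s χ : ℝ) : Prop :=
  Tendsto (fun x : ℝ × ℝ × ℝ => curvatureQuotient e (c x.1) (c x.2.1) (c x.2.2))
    (𝓝[{x | x.1 ∈ I ∧ x.2.1 ∈ I ∧ x.2.2 ∈ I ∧ x.1 ≠ x.2.1 ∧ x.2.1 ≠ x.2.2 ∧ x.1 ≠ x.2.2}]
      (s, s, s)) (𝓝 χ)

/-- The orientation (`1`, `0`, `-1`) of the triangle `p₀ p₁ p₂`; it is `1` for a left turn. -/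
def turn (p₀ p₁ p₂ : X) : ℝ :=
  Real.sign ((starRingEnd ℂ (e (p₁ - p₀)) * e (p₂ - p₁)).im)

/-- `χ` is the Busemann curvature at parameter `s` of the curve `c`, counted with sign: the curve
is traversed towards larger parameters if `0 < d`, towards smaller ones if `d < 0`, and
left turns count as positive. -/
def HasOrientedBusemannCurvature (c : ℝ → X) (I : Set ℝ) (s d χ : ℝ) : Prop :=
  Tendsto (fun x : ℝ × ℝ × ℝ =>
      turn e (c x.1) (c x.2.1) (c x.2.2) * curvatureQuotient e (c x.1) (c x.2.1) (c x.2.2))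
    (𝓝[{x | x.1 ∈ I ∧ x.2.1 ∈ I ∧ x.2.2 ∈ I ∧ 0 < d * (x.2.1 - x.1) ∧ 0 < d * (x.2.2 - x.2.1)}]
      (s, s, s)) (𝓝 χ)

/-- The curvature radius, with the usual convention that `1 / r = 0` when the curvature is `0`. -/
def curvatureRadius (χ : ℝ) : ℝ := 1 / χ

/-! ### General rotations given by the arc-length of the unit circle -/

/-- The point of the unit circle on the ray with Euclidean polar angle `θ`. -/
def circlePoint (θ : ℝ) : X :=
  ‖e.symm (Complex.exp (θ * Complex.I))‖⁻¹ • e.symm (Complex.exp (θ * Complex.I))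

/-- The signed normalized Minkowskian arc-length of the unit circle, counted counterclockwise from
polar angle `0` to polar angle `θ`; the whole circle has measure `2 π`. -/
def arcAngle (θ : ℝ) : ℝ :=
  2 * Real.pi * variationOnFromTo (circlePoint e) univ 0 θ /
    variationOnFromTo (circlePoint e) univ 0 (2 * Real.pi)

/-- The general rotation about the origin by the arc-length angle `φ`: it preserves the norm, and
it moves the polar angle so that `arcAngle` increases by `φ`.
(`arcAngle e` is an increasing bijection of `ℝ`.) -/
def rot (φ : ℝ) (x : X) : X :=
  ‖x‖ • circlePoint e (Function.invFun (arcAngle e) (arcAngle e (e x).arg + φ))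

/-- The arc-length angle from the direction of `u` to the direction of `v` (modulo `2 π`). -/
def dirAngle (u v : X) : ℝ := arcAngle e (e v).arg - arcAngle e (e u).arg

/-! ### Rolling and flexible motions -/

/-- The curve `γ'` rolls without slipping on the curve `γ` during `[0, β]`: the curves touch at
their common starting point, and both are parametrized by Minkowskian arc-length. -/
structure RollsWithoutSlipping (γ' γ : ℝ → X) (β : ℝ) : Prop where
  start_eq : γ 0 = γ' 0
  touch : derivWithin γ (Icc 0 β) 0 = derivWithin γ' (Icc 0 β) 0
  arclength_fixed : HasUnitSpeedOn γ (Icc 0 β)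
  arclength_moving : HasUnitSpeedOn γ' (Icc 0 β)

/-- The angle `φ_s` of the general rotation that takes the tangent direction of `γ'` at `γ' s` to
the tangent direction of `γ` at `γ s`. -/
def motionAngle (γ γ' : ℝ → X) (β s : ℝ) : ℝ :=
  dirAngle e (derivWithin γ' (Icc 0 β) s) (derivWithin γ (Icc 0 β) s)

/-- The flexible motion `Φ_s` that corresponds to the rolling of `γ'` on `γ`. -/
def flexibleMotion (γ γ' : ℝ → X) (β s : ℝ) (p : X) : X :=
  γ s + rot e (motionAngle e γ γ' β s) (p - γ' s)

/-- The moving polode in the position that it has at the moment `s`. -/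
def movedPolode (γ γ' : ℝ → X) (β s : ℝ) (t : ℝ) : X :=
  flexibleMotion e γ γ' β s (γ' t)

/-- The directed Euclidean angle by which the motion turns the tangent of `γ` at `γ s` between the
moments `s` and `t` (with values in `(-π, π]`, and `0` for `t = s`). -/
def turningAngle (γ γ' : ℝ → X) (β s t : ℝ) : ℝ :=
  (e (rot e (motionAngle e γ γ' β t - motionAngle e γ γ' β s) (derivWithin γ (Icc 0 β) s)) /
    e (derivWithin γ (Icc 0 β) s)).arg

/-- The derivative of the Euclidean turning angle with respect to arc-length, at the moment `s`. -/
def turningRate (γ γ' : ℝ → X) (β s : ℝ) : ℝ :=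
  derivWithin (turningAngle e γ γ' β s) (Icc 0 β) s

/-- The velocity vector of the curve `c` at the moment `s`: its derivative with respect to the
Euclidean turning angle of the motion. -/
def polodeVelocity (γ γ' : ℝ → X) (β : ℝ) (c : ℝ → X) (s : ℝ) : X :=
  (turningRate e γ γ' β s)⁻¹ • derivWithin c (Icc 0 β) s

end

end NormedPlane

/-! Write `x` for the unit tangent of `γ` at `s`, `∧` for the Euclidean oriented area, `R` for the
general rotation at the moment `s`. Expanding the curvature quotient to second order shows that a C²
curve `c`, traversed towards larger parameters, has signed Busemann curvature σ(T) (c' ∧ c'') /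
‖c'‖³ (`hasOrientedBusemannCurvature`). Both polodes have derivative `x` at `K`, so the difference
of their curvatures is, up to the sign of ω̇, equal to σ(T) x ∧ (γ'' - Y'), where `Y'` is the second
derivative of the moved polode.

The moved polode is the image under `R` of chords that shrink to 0, and `R` is known to be C² only
away from 0. Homogeneity helps: the chord may be replaced by its divided difference, and Euler's
identity kills the term with the second derivative of `R`. Hence `Y'` is the differential of `R` at
the tangent of the moving polode, applied to the second derivative of that polode
(`hasStrictDerivAt_homogeneous_chord`). The same vector is the derivative of the tangent of the
moving polode carried along by `R`.

In arc-length angle the motion turns by the difference of the angles of these two tangents. Passing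
to arc-length angle and back multiplies and divides by the same density in the direction `x`, so ω̇
= x ∧ (γ'' - Y') / ‖x‖_E² (`turningRate_eq`). Since σ(t_K) = 1/‖x‖_E and α_K = 1/|ω̇|, the claim
follows. -/

namespace NormedPlane

/-! ### Variation and speed of curves. -/

section Variation

variable {E : Type*} [NormedAddCommGroup E] [NormedSpace ℝ E]

/-- Near `a` the curve is Lipschitz with constant `‖f'‖ + ε`, which bounds the variation above; the
length of the single chord bounds it below. -/
theorem eVariationOn_Icc_bounds {f : ℝ → E} {f' : E} {a : ℝ} (h : HasStrictDerivAt f f' a)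
    {ε : ℝ} (hε : 0 < ε) :
    ∃ δ > 0, ∀ x ∈ Metric.ball a δ, ∀ y ∈ Metric.ball a δ, x ≤ y →
      eVariationOn f (Icc x y) ≤ ENNReal.ofReal ((‖f'‖ + ε) * (y - x)) ∧
      ENNReal.ofReal ((‖f'‖ - ε) * (y - x)) ≤ eVariationOn f (Icc x y) := by
  have h1 := (hasStrictDerivAt_iff_hasStrictFDerivAt.1 h).isLittleO.def hε
  rw [nhds_prod_eq, Metric.nhds_basis_ball.prod_self.eventually_iff] at h1
  obtain ⟨δ, hδ, h1⟩ := h1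
  refine ⟨δ, hδ, fun x hx y hy hxy => ?_⟩
  have key : ∀ p ∈ Metric.ball a δ, ∀ q ∈ Metric.ball a δ,
      ‖f p - f q - (p - q) • f'‖ ≤ ε * |p - q| := fun p hp q hq => by
    simpa using h1 (show (p, q) ∈ _ from ⟨hp, hq⟩)
  have hsub : Icc x y ⊆ Metric.ball a δ := by
    rw [Real.ball_eq_Ioo] at *
    exact fun z hz => ⟨hx.1.trans_le hz.1, hz.2.trans_lt hy.2⟩
  constructor
  · have hC : 0 ≤ ‖f'‖ + ε := by positivity
    have hl : LipschitzOnWith (‖f'‖ + ε).toNNReal f (Icc x y) := by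
      refine LipschitzOnWith.of_dist_le_mul fun p hp q hq => ?_
      rw [dist_eq_norm, Real.dist_eq, Real.coe_toNNReal _ hC]
      have := key p (hsub hp) q (hsub hq)
      calc ‖f p - f q‖ = ‖(f p - f q - (p - q) • f') + (p - q) • f'‖ := by simp
        _ ≤ ε * |p - q| + |p - q| * ‖f'‖ := by
          refine (norm_add_le _ _).trans (add_le_add this ?_)
          rw [norm_smul, Real.norm_eq_abs]
        _ = _ := by ring
    have := hl.comp_eVariationOn_le (g := id) (s := Icc x y) (mapsTo_id _)
    rw [eVariationOn_id_Icc, Function.comp_id] at this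
    rwa [ENNReal.ofReal_mul hC]
  · refine le_trans ?_ (eVariationOn.edist_le f (right_mem_Icc.2 hxy) (left_mem_Icc.2 hxy))
    rw [edist_dist, dist_eq_norm]
    refine ENNReal.ofReal_le_ofReal ?_
    have h2 := key y hy x hx
    have h3 := norm_sub_norm_le ((y - x) • f') (f y - f x)
    rw [norm_sub_rev ((y - x) • f'), norm_smul, Real.norm_eq_abs,
      abs_of_nonneg (sub_nonneg.2 hxy)] at h3
    rw [abs_of_nonneg (sub_nonneg.2 hxy)] at h2
    linarith

theorem hasStrictDerivAt_variationOnFromTo {f : ℝ → E}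
    (hf : LocallyBoundedVariationOn f univ) {f' : E} {a : ℝ} (h : HasStrictDerivAt f f' a)
    (b : ℝ) : HasStrictDerivAt (variationOnFromTo f univ b) ‖f'‖ a := by
  rw [hasStrictDerivAt_iff_hasStrictFDerivAt]
  refine .of_isLittleO (Asymptotics.IsLittleO.of_bound fun ε hε => ?_)
  obtain ⟨δ, hδ, H⟩ := eVariationOn_Icc_bounds h hε
  have key : ∀ x ∈ Metric.ball a δ, ∀ y ∈ Metric.ball a δ, x ≤ y →
      |variationOnFromTo f univ b y - variationOnFromTo f univ b x - (y - x) * ‖f'‖|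
        ≤ ε * (y - x) := fun x hx y hy hxy => by
    have e1 := variationOnFromTo.add hf (mem_univ b) (mem_univ x) (mem_univ y)
    have e2 := variationOnFromTo.eq_of_le f univ hxy
    rw [univ_inter] at e2
    obtain ⟨h1, h2⟩ := H x hx y hy hxy
    have hfin : eVariationOn f (Icc x y) ≠ ⊤ := ne_top_of_le_ne_top ENNReal.ofReal_ne_top h1
    rw [ENNReal.ofReal_le_iff_le_toReal hfin] at h2
    have h1' := ENNReal.toReal_le_of_le_ofReal
      (mul_nonneg (by positivity) (sub_nonneg.2 hxy)) h1
    rw [← e2] at h1' h2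
    rw [abs_le]
    constructor <;> linarith
  rw [nhds_prod_eq]
  filter_upwards [prod_mem_prod (Metric.ball_mem_nhds a hδ) (Metric.ball_mem_nhds a hδ)]
    with p hp
  simp only [ContinuousLinearMap.toSpanSingleton_apply, smul_eq_mul, Real.norm_eq_abs]
  rcases le_total p.2 p.1 with hle | hle
  · rw [abs_of_nonneg (sub_nonneg.2 hle)]
    exact key _ hp.2 _ hp.1 hle
  · rw [abs_sub_comm p.1 p.2, abs_of_nonneg (sub_nonneg.2 hle), ← abs_neg]
    convert key _ hp.1 _ hp.2 hle using 2
    ring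

/-- Unit speed is defined through variation; on short intervals near `a` the variation is nearly
`‖f'‖` times the length. -/
theorem norm_eq_one_of_hasUnitSpeedOn {f : ℝ → E} {β : ℝ} (hβ : 0 < β)
    (hu : HasUnitSpeedOn f (Icc 0 β)) {f' : E} {a : ℝ} (ha : a ∈ Icc 0 β)
    (h : HasStrictDerivAt f f' a) : ‖f'‖ = 1 := by
  have key : ∀ ε > 0, |‖f'‖ - 1| ≤ ε := fun ε hε => by
    obtain ⟨δ, hδ, H⟩ := eVariationOn_Icc_bounds h hε
    -- The short interval lies to the right of `a`, or to the left if `a = β`, so endpoints are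
    -- covered.
    obtain ⟨x, y, hx, hy, hx', hy', hxy⟩ : ∃ x y, x ∈ Icc 0 β ∧ y ∈ Icc 0 β ∧
        x ∈ Metric.ball a δ ∧ y ∈ Metric.ball a δ ∧ x < y := by
      simp only [Real.ball_eq_Ioo, mem_Icc, mem_Ioo] at *
      rcases lt_or_ge a β with hlt | hge
      · refine ⟨a, min β (a + δ / 2), ha, ⟨le_min hβ.le (by linarith), min_le_left _ _⟩,
          ⟨by linarith, by linarith⟩, ⟨?_, ?_⟩, lt_min hlt (by linarith)⟩
        · exact lt_min (by linarith) (by linarith)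
        · exact (min_le_right _ _).trans_lt (by linarith)
      · refine ⟨max 0 (a - δ / 2), a, ⟨le_max_left _ _, max_le hβ.le (by linarith)⟩, ha,
          ⟨?_, ?_⟩, ⟨by linarith, by linarith⟩, max_lt (by linarith) (by linarith)⟩
        · exact (show a - δ < a - δ / 2 by linarith).trans_le (le_max_right _ _)
        · exact max_lt (by linarith) (by linarith)
    have e := hu hx hy
    rw [inter_eq_self_of_subset_right (Icc_subset_Icc hx.1 hy.2)] at e
    obtain ⟨h1, h2⟩ := H x hx' y hy' hxy.le
    have hpos := sub_pos.2 hxy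
    rw [e] at h1 h2
    simp only [NNReal.coe_one, one_mul] at h1 h2
    rw [ENNReal.ofReal_le_ofReal_iff hpos.le] at h2
    rw [ENNReal.ofReal_le_ofReal_iff (by positivity)] at h1
    rw [abs_le]
    constructor <;> nlinarith
  have := le_of_forall_gt_imp_ge_of_dense (a₁ := |‖f'‖ - 1|) (a₂ := 0) fun ε hε => key ε hε
  linarith [abs_eq_zero.1 (le_antisymm this (abs_nonneg _))]

end Variation

/-! ### Extension of C² curves, and divided differences. -/

section Calculus

variable {E : Type*} [NormedAddCommGroup E] [NormedSpace ℝ E]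

/-- A curve of class `C^2` on a compact interval is the restriction of a `C^2` curve on `ℝ`. -/
theorem exists_contDiff_two_eqOn_Icc [CompleteSpace E] {f : ℝ → E} {β : ℝ} (hβ : 0 < β)
    (hf : ContDiffOn ℝ 2 f (Icc 0 β)) : ∃ g : ℝ → E, ContDiff ℝ 2 g ∧ EqOn g f (Icc 0 β) := by
  have hu := uniqueDiffOn_Icc hβ
  have h1 : ContDiffOn ℝ 1 (derivWithin f (Icc 0 β)) (Icc 0 β) := hf.derivWithin hu (by norm_num)
  have h2 : ContinuousOn (derivWithin (derivWithin f (Icc 0 β)) (Icc 0 β)) (Icc 0 β) :=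
    h1.continuousOn_derivWithin hu le_rfl
  set f1 := derivWithin f (Icc 0 β) with hf1
  set f2 := derivWithin f1 (Icc 0 β) with hf2
  -- A function is extended by integrating an extension of its derivative. Starting from the
  -- constant continuation of the second derivative, two integrations give `g`.
  have step : ∀ (p q : ℝ → E), ContinuousOn p (Icc 0 β) →
      (∀ x ∈ Icc 0 β, HasDerivWithinAt p (q x) (Icc 0 β) x) → ∀ Q : ℝ → E, Continuous Q →
      EqOn Q q (Icc 0 β) → ∃ P : ℝ → E, (∀ x, HasDerivAt P (Q x) x) ∧ EqOn P p (Icc 0 β) := by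
    intro p q hp hq Q hQ hQq
    refine ⟨fun x => p 0 + ∫ t in (0 : ℝ)..x, Q t, fun x => ?_, fun x hx => ?_⟩
    · exact (intervalIntegral.integral_hasDerivAt_right (hQ.intervalIntegrable _ _)
        (hQ.stronglyMeasurableAtFilter _ _) hQ.continuousAt).const_add _
    · have : ∫ t in (0 : ℝ)..x, Q t = p x - p 0 := by
        refine intervalIntegral.integral_eq_sub_of_hasDerivAt_of_le hx.1
          (hp.mono (Icc_subset_Icc_right hx.2)) (fun t ht => ?_) (hQ.intervalIntegrable _ _)
        have htI : t ∈ Icc 0 β := ⟨ht.1.le, ht.2.le.trans hx.2⟩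
        rw [hQq htI]
        exact (hq t htI).hasDerivAt (Icc_mem_nhds ht.1 (ht.2.trans_le hx.2))
      simp [this]
  have hQ : Continuous (IccExtend hβ.le ((Icc 0 β).domRestrict f2)) :=
    (continuousOn_iff_continuous_domRestrict.1 h2).Icc_extend'
  obtain ⟨P, hP, hPf⟩ := step f1 f2 h1.continuousOn
    (fun x hx => (h1.differentiableOn (by norm_num) x hx).hasDerivWithinAt) _ hQ
    (fun x hx => IccExtend_of_mem _ _ hx)
  have hPc : Continuous P := continuous_iff_continuousAt.2 fun x => (hP x).continuousAt
  obtain ⟨g, hg, hgf⟩ := step f f1 hf.continuousOn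
    (fun x hx => (hf.differentiableOn (by norm_num) x hx).hasDerivWithinAt) P hPc hPf
  refine ⟨g, ?_, hgf⟩
  rw [show (2 : WithTop ℕ∞) = 1 + 1 by norm_num, contDiff_succ_iff_deriv]
  refine ⟨fun x => (hg x).differentiableAt, by simp, ?_⟩
  rw [show deriv g = P from funext fun x => (hg x).deriv, contDiff_one_iff_deriv]
  refine ⟨fun x => (hP x).differentiableAt, ?_⟩
  rwa [show deriv P = _ from funext fun x => (hP x).deriv]

/-- The divided difference of `c` at `a` and `b` is the mean of its derivative on the segment
from `a` to `b`. -/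
theorem exists_primitive_dslope {c c₁ : ℝ → E} {a b : ℝ}
    (h : ∀ τ ∈ Icc (0 : ℝ) 1, HasDerivAt c (c₁ (a + τ * (b - a))) (a + τ * (b - a))) :
    ∃ ψ : ℝ → E, (∀ τ ∈ Icc (0 : ℝ) 1, HasDerivAt ψ (c₁ (a + τ * (b - a))) τ) ∧
      ψ 1 - ψ 0 = dslope c a b := by
  rcases eq_or_ne b a with rfl | hne
  · refine ⟨fun τ => τ • c₁ b, fun τ _ => ?_, ?_⟩
    · simpa using (hasDerivAt_id τ).smul_const (c₁ b)
    · have := (h 0 (by simp)).deriv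
      simp only [sub_self, mul_zero, add_zero] at this
      simp [this]
  · have hba : b - a ≠ 0 := sub_ne_zero.2 hne
    refine ⟨fun τ => (b - a)⁻¹ • c (a + τ * (b - a)), fun τ hτ => ?_, ?_⟩
    · have h1 : HasDerivAt (fun τ => a + τ * (b - a)) (b - a) τ := by
        simpa using ((hasDerivAt_id τ).mul_const (b - a)).const_add a
      have := ((h τ hτ).scomp τ h1).const_smul (b - a)⁻¹
      rwa [smul_smul, inv_mul_cancel₀ hba, one_smul] at this
    · rw [dslope_of_ne _ hne, slope_def_module, ← smul_sub]
      simp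

/-- The divided differences of a curve whose derivative is strictly differentiable at `s` are
strictly differentiable at `s`, uniformly in the base point. -/
theorem dslope_sub_dslope_bound {c c₁ : ℝ → E} {c₂ : E} {s : ℝ}
    (h : ∀ᶠ t in 𝓝 s, HasDerivAt c (c₁ t) t) (h₂ : HasStrictDerivAt c₁ c₂ s)
    {ε : ℝ} (hε : 0 < ε) :
    ∃ δ > 0, ∀ a ∈ Metric.ball s δ, ∀ x ∈ Metric.ball s δ, ∀ y ∈ Metric.ball s δ,
      ‖dslope c a x - dslope c a y - ((x - y) / 2) • c₂‖ ≤ ε * |x - y| := by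
  have h1 := (hasStrictDerivAt_iff_hasStrictFDerivAt.1 h₂).isLittleO.def hε
  rw [nhds_prod_eq, Metric.nhds_basis_ball.prod_self.eventually_iff] at h1
  obtain ⟨δ₁, hδ₁, h1⟩ := h1
  obtain ⟨δ₂, hδ₂, h⟩ := Metric.nhds_basis_ball.eventually_iff.1 h
  refine ⟨min δ₁ δ₂, lt_min hδ₁ hδ₂, fun a ha x hx y hy => ?_⟩
  have hmem : ∀ b ∈ Metric.ball s (min δ₁ δ₂), ∀ τ ∈ Icc (0 : ℝ) 1,
      a + τ * (b - a) ∈ Metric.ball s (min δ₁ δ₂) := fun b hb τ hτ => by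
    simpa using (convex_ball s (min δ₁ δ₂)).add_smul_sub_mem ha hb hτ
  have hder : ∀ b ∈ Metric.ball s (min δ₁ δ₂), ∀ τ ∈ Icc (0 : ℝ) 1,
      HasDerivAt c (c₁ (a + τ * (b - a))) (a + τ * (b - a)) := fun b hb τ hτ =>
    h (Metric.ball_subset_ball (min_le_right _ _) (hmem b hb τ hτ))
  obtain ⟨ψ, hψ, hψx⟩ := exists_primitive_dslope (hder x hx)
  obtain ⟨η, hη, hηy⟩ := exists_primitive_dslope (hder y hy)
  -- Mean value inequality on [0, 1]: strict differentiability of `c₁` controls the derivative, and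
  -- integrating `τ * (x - y)` produces the factor 1/2.
  have key := norm_image_sub_le_of_norm_deriv_le_segment_01'
    (f := fun τ => ψ τ - η τ - (τ ^ 2 * ((x - y) / 2)) • c₂) (C := ε * |x - y|)
    (f' := fun τ => c₁ (a + τ * (x - a)) - c₁ (a + τ * (y - a)) - (τ * (x - y)) • c₂)
    (fun τ hτ => by
      refine (((hψ τ hτ).sub (hη τ hτ)).sub (HasDerivAt.smul_const ?_ c₂)).hasDerivWithinAt
      convert (hasDerivAt_pow 2 τ).mul_const ((x - y) / 2) using 1
      norm_num
      ring)
    (fun τ hτ => by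
      have hτ' : τ ∈ Icc (0 : ℝ) 1 := ⟨hτ.1, hτ.2.le⟩
      have := h1 (show (a + τ * (x - a), a + τ * (y - a)) ∈ _ from
        ⟨Metric.ball_subset_ball (min_le_left _ _) (hmem x hx τ hτ'),
         Metric.ball_subset_ball (min_le_left _ _) (hmem y hy τ hτ')⟩)
      have e1 : a + τ * (x - a) - (a + τ * (y - a)) = τ * (x - y) := by ring
      simp only [ContinuousLinearMap.toSpanSingleton_apply, e1, Real.norm_eq_abs, abs_mul,
        abs_of_nonneg hτ'.1] at this
      refine this.trans ?_
      have : τ * |x - y| ≤ 1 * |x - y| := mul_le_mul_of_nonneg_right hτ'.2 (abs_nonneg _)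
      nlinarith)
  convert key using 2
  rw [← hψx, ← hηy]
  simp only [one_pow, one_mul, zero_pow two_ne_zero, zero_mul, zero_smul]
  abel

theorem hasStrictDerivAt_dslope {c c₁ : ℝ → E} {c₂ : E} {s : ℝ}
    (h : ∀ᶠ t in 𝓝 s, HasDerivAt c (c₁ t) t) (h₂ : HasStrictDerivAt c₁ c₂ s) :
    HasStrictDerivAt (dslope c s) ((1 / 2 : ℝ) • c₂) s := by
  rw [hasStrictDerivAt_iff_hasStrictFDerivAt]
  refine .of_isLittleO (Asymptotics.IsLittleO.of_bound fun ε hε => ?_)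
  obtain ⟨δ, hδ, H⟩ := dslope_sub_dslope_bound h h₂ hε
  rw [nhds_prod_eq]
  filter_upwards [prod_mem_prod (Metric.ball_mem_nhds s hδ) (Metric.ball_mem_nhds s hδ)]
    with p hp
  have := H s (Metric.mem_ball_self hδ) _ hp.1 _ hp.2
  simpa [smul_smul, div_eq_mul_inv] using this

end Calculus

/-! ### Busemann curvature of a C² curve. -/

section Curvature

variable {X : Type*} [NormedAddCommGroup X] [NormedSpace ℝ X] (e : X ≃L[ℝ] ℂ)

/-- The Euclidean oriented area of the parallelogram spanned by `u` and `v`. -/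
noncomputable def wedge (u v : X) : ℝ := (starRingEnd ℂ (e u) * e v).im

theorem wedge_eq (u v : X) : wedge e u v = (e u).re * (e v).im - (e u).im * (e v).re := by
  simp [wedge]; ring

theorem wedge_smul_smul (a b : ℝ) (u v : X) : wedge e (a • u) (b • v) = a * b * wedge e u v := by
  simp [wedge_eq]; ring

theorem wedge_smul_right (b : ℝ) (u v : X) : wedge e u (b • v) = b * wedge e u v := by
  simp [wedge_eq]; ring

theorem wedge_sub_self (u v : X) : wedge e u (v - u) = wedge e u v := by
  simp [wedge_eq]; ring

theorem continuous_wedge : Continuous fun p : X × X => wedge e p.1 p.2 := by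
  unfold wedge; fun_prop

theorem volume_image_parallelepiped (u v : X) :
    (volume (e '' parallelepiped ![u, v])).toReal = |wedge e u v| := by
  have h1 : e '' parallelepiped ![u, v] = parallelepiped ![e u, e v] := by
    have := image_parallelepiped (e : X →L[ℝ] ℂ).toLinearMap ![u, v]
    rw [show ![e u, e v] = ⇑(e : X →L[ℝ] ℂ).toLinearMap ∘ ![u, v] by
      funext i
      fin_cases i <;> rfl]
    exact this
  rw [h1, ← Complex.orthonormalBasisOneI.addHaar_eq_volume, Measure.addHaar_parallelepiped,
    Complex.toBasis_orthonormalBasisOneI, ENNReal.toReal_ofReal (abs_nonneg _),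
    Module.Basis.det_apply, Matrix.det_fin_two]
  simp [Module.Basis.toMatrix_apply, wedge_eq]
  ring_nf

theorem sigmaPlane_nonneg : 0 ≤ sigmaPlane e :=
  div_nonneg Real.pi_pos.le ENNReal.toReal_nonneg

theorem curvatureQuotient_eq (p₀ p₁ p₂ : X) : curvatureQuotient e p₀ p₁ p₂ =
    2 * sigmaPlane e * |wedge e (p₁ - p₀) (p₂ - p₁)| /
      (‖p₁ - p₀‖ * ‖p₂ - p₁‖ * ‖p₂ - p₀‖) := by
  rw [curvatureQuotient, busemannSine, busemannArea, volume_image_parallelepiped]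
  rw [mul_div_assoc', div_div, mul_assoc 2]

theorem turn_mul_curvatureQuotient (p₀ p₁ p₂ : X) :
    turn e p₀ p₁ p₂ * curvatureQuotient e p₀ p₁ p₂ =
    2 * sigmaPlane e * wedge e (p₁ - p₀) (p₂ - p₁) /
      (‖p₁ - p₀‖ * ‖p₂ - p₁‖ * ‖p₂ - p₀‖) := by
  rw [curvatureQuotient_eq]
  have : turn e p₀ p₁ p₂ * |wedge e (p₁ - p₀) (p₂ - p₁)| = wedge e (p₁ - p₀) (p₂ - p₁) := by
    rw [turn, ← wedge]
    rcases lt_trichotomy (wedge e (p₁ - p₀) (p₂ - p₁)) 0 with h | h | h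
    · rw [Real.sign_of_neg h, abs_of_neg h]; ring
    · simp [h]
    · rw [Real.sign_of_pos h, abs_of_pos h, one_mul]
  rw [mul_div_assoc', mul_left_comm, this]

theorem abs_turn_mul_curvatureQuotient (p₀ p₁ p₂ : X) :
    |turn e p₀ p₁ p₂ * curvatureQuotient e p₀ p₁ p₂| = curvatureQuotient e p₀ p₁ p₂ := by
  rw [turn_mul_curvatureQuotient, curvatureQuotient_eq, abs_div, abs_mul,
    abs_of_nonneg (mul_nonneg zero_le_two (sigmaPlane_nonneg e)),
    abs_of_nonneg (a := _ * _ * ‖_‖) (by positivity)]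

/-- For `v ≠ 0`, the sigma function of a line is the ratio of the two lengths on it. -/
theorem sigmaLine_eq {v : X} (hv : v ≠ 0) : sigmaLine e v = ‖v‖ / ‖e v‖ := by
  have hv' : 0 < ‖v‖ := norm_pos_iff.2 hv
  have hev : 0 < ‖e v‖ := norm_pos_iff.2 fun h => hv (by simpa using h)
  have hset : {x : X | x ∈ Submodule.span ℝ {v} ∧ ‖x‖ ≤ 1} =
      segment ℝ (-(‖v‖⁻¹ • v)) (‖v‖⁻¹ • v) := by
    ext x
    simp only [mem_ofPred_eq, Submodule.mem_span_singleton, segment_eq_image', mem_image]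
    constructor
    · rintro ⟨⟨a, rfl⟩, ha⟩
      rw [norm_smul, Real.norm_eq_abs] at ha
      have h2 := abs_le.1 (show |a * ‖v‖| ≤ 1 by rwa [abs_mul, abs_norm])
      refine ⟨(a * ‖v‖ + 1) / 2, ⟨by linarith, by linarith⟩, ?_⟩
      rw [← neg_smul, ← sub_smul, smul_smul, ← add_smul]
      congr 1
      field_simp
      ring
    · rintro ⟨θ, hθ, rfl⟩
      have e1 : -(‖v‖⁻¹ • v) + θ • (‖v‖⁻¹ • v - -(‖v‖⁻¹ • v)) = ((2 * θ - 1) * ‖v‖⁻¹) • v := by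
        rw [← neg_smul, ← sub_smul, smul_smul, ← add_smul]
        congr 1
        ring
      rw [e1]
      refine ⟨⟨_, rfl⟩, ?_⟩
      rw [norm_smul, Real.norm_eq_abs, abs_mul, abs_inv, abs_norm, inv_mul_cancel_right₀ hv'.ne',
        abs_le]
      constructor <;> linarith [hθ.1, hθ.2]
  have himg : e '' segment ℝ (-(‖v‖⁻¹ • v)) (‖v‖⁻¹ • v) =
      segment ℝ (e (-(‖v‖⁻¹ • v))) (e (‖v‖⁻¹ • v)) :=
    image_segment ℝ (e : X →L[ℝ] ℂ).toLinearMap.toAffineMap _ _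
  rw [sigmaLine, hset, himg, hausdorffMeasure_segment, edist_dist,
    ENNReal.toReal_ofReal dist_nonneg, dist_eq_norm, ← map_sub, ← neg_add', map_neg, norm_neg,
    ← two_smul ℝ (_ : X), smul_smul, map_smul, norm_smul, Real.norm_eq_abs,
    abs_of_pos (by positivity)]
  field_simp

theorem tendsto_slope_of_hasStrictDerivAt {E : Type*} [NormedAddCommGroup E] [NormedSpace ℝ E]
    {c : ℝ → E} {c' : E} {s : ℝ} (h : HasStrictDerivAt c c' s) :
    Tendsto (fun p : ℝ × ℝ => slope c p.1 p.2) (𝓝[{p | p.1 ≠ p.2}] (s, s)) (𝓝 c') := by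
  rw [Metric.tendsto_nhds]
  intro ε hε
  have h1 := (hasStrictDerivAt_iff_hasStrictFDerivAt.1 h).isLittleO.def (half_pos hε)
  filter_upwards [nhdsWithin_le_nhds h1, self_mem_nhdsWithin] with p hp hne
  have hne' : p.2 - p.1 ≠ 0 := sub_ne_zero.2 (Ne.symm hne)
  rw [dist_eq_norm]
  have e1 : slope c p.1 p.2 - c' =
      (p.2 - p.1)⁻¹ • (c p.2 - c p.1 - (p.2 - p.1) • c') := by
    rw [smul_sub, smul_smul, inv_mul_cancel₀ hne', one_smul, slope_def_module]
  have e2 : ‖c p.2 - c p.1 - (p.2 - p.1) • c'‖ ≤ ε / 2 * |p.2 - p.1| := by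
    rw [← norm_neg, abs_sub_comm, show -(c p.2 - c p.1 - (p.2 - p.1) • c') =
      c p.1 - c p.2 - (p.1 - p.2) • c' by rw [sub_smul, sub_smul]; abel]
    exact hp
  rw [e1, norm_smul, norm_inv, Real.norm_eq_abs, inv_mul_lt_iff₀ (abs_pos.2 hne')]
  nlinarith [abs_pos.2 hne']

/-- Pull the parameter increments out of the chords. Since `A ∧ B = A ∧ (B - A)` for consecutive
slopes, the quotient becomes a continuous expression in slopes and a second divided difference,
times the product of the three increments over its absolute value. The sign factor cancels the
latter, so one limit over all distinct triples serves both notions of curvature. -/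
theorem tendsto_signed_curvature {c c₁ : ℝ → X} {c₂ : X} {s : ℝ}
    (h : ∀ᶠ t in 𝓝 s, HasDerivAt c (c₁ t) t) (h₂ : HasStrictDerivAt c₁ c₂ s) (h0 : c₁ s ≠ 0) :
    Tendsto (fun x : ℝ × ℝ × ℝ =>
      (SignType.sign ((x.2.1 - x.1) * (x.2.2 - x.2.1) * (x.2.2 - x.1)) : ℝ) *
        (turn e (c x.1) (c x.2.1) (c x.2.2) * curvatureQuotient e (c x.1) (c x.2.1) (c x.2.2)))
      (𝓝[{x | x.1 ≠ x.2.1 ∧ x.2.1 ≠ x.2.2 ∧ x.1 ≠ x.2.2}] (s, s, s))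
      (𝓝 (sigmaPlane e * wedge e (c₁ s) c₂ / ‖c₁ s‖ ^ 3)) := by
  have hst : HasStrictDerivAt c (c₁ s) s :=
    hasStrictDerivAt_of_hasDerivAt_of_continuousAt h h₂.hasDerivAt.continuousAt
  have hsl := tendsto_slope_of_hasStrictDerivAt hst
  set l := 𝓝[{x : ℝ × ℝ × ℝ | x.1 ≠ x.2.1 ∧ x.2.1 ≠ x.2.2 ∧ x.1 ≠ x.2.2}] (s, s, s) with hl
  have aux : ∀ u v : ℝ × ℝ × ℝ → ℝ, Continuous u → Continuous v → u (s, s, s) = s →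
      v (s, s, s) = s → (∀ x : ℝ × ℝ × ℝ, x.1 ≠ x.2.1 ∧ x.2.1 ≠ x.2.2 ∧ x.1 ≠ x.2.2 → u x ≠ v x) →
      Tendsto (fun x => slope c (u x) (v x)) l (𝓝 (c₁ s)) := fun u v hu hv hus hvs huv => by
    refine hsl.comp (f := fun x => (u x, v x)) (tendsto_nhdsWithin_of_tendsto_nhds_of_eventually_within _ ?_ ?_)
    · have : Tendsto (fun x => (u x, v x)) (𝓝 (s, s, s)) (𝓝 (s, s)) := by
        have := (hu.prodMk hv).tendsto (s, s, s)
        rwa [hus, hvs] at this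
      exact this.mono_left nhdsWithin_le_nhds
    · filter_upwards [self_mem_nhdsWithin] with x hx using huv x hx
  have t01 := aux (fun x => x.1) (fun x => x.2.1) (by fun_prop) (by fun_prop) rfl rfl
    fun x hx => hx.1
  have t12 := aux (fun x => x.2.1) (fun x => x.2.2) (by fun_prop) (by fun_prop) rfl rfl
    fun x hx => hx.2.1
  have t02 := aux (fun x => x.1) (fun x => x.2.2) (by fun_prop) (by fun_prop) rfl rfl
    fun x hx => hx.2.2
  -- The two slopes are divided differences with the common base point `x.2.1`, which moves; hence
  -- the need for a bound uniform in the base point.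
  have tdd : Tendsto (fun x : ℝ × ℝ × ℝ =>
      (x.2.2 - x.1)⁻¹ • (slope c x.2.1 x.2.2 - slope c x.1 x.2.1)) l (𝓝 ((1 / 2 : ℝ) • c₂)) := by
    rw [Metric.tendsto_nhds]
    intro ε hε
    obtain ⟨δ, hδ, H⟩ := dslope_sub_dslope_bound h h₂ (half_pos hε)
    have hb := Metric.ball_mem_nhds s hδ
    have : Metric.ball s δ ×ˢ Metric.ball s δ ×ˢ Metric.ball s δ ∈ 𝓝 (s, s, s) := by
      rw [nhds_prod_eq, nhds_prod_eq]
      exact prod_mem_prod hb (prod_mem_prod hb hb)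
    filter_upwards [nhdsWithin_le_nhds this, self_mem_nhdsWithin] with x hx hne
    have hne' : x.2.2 - x.1 ≠ 0 := sub_ne_zero.2 (Ne.symm hne.2.2)
    have h3 := H _ hx.2.1 _ hx.2.2 _ hx.1
    rw [dslope_of_ne _ hne.2.1.symm, dslope_of_ne _ hne.1, slope_comm c x.2.1 x.1] at h3
    rw [dist_eq_norm]
    have e1 : (x.2.2 - x.1)⁻¹ • (slope c x.2.1 x.2.2 - slope c x.1 x.2.1) - (1 / 2 : ℝ) • c₂ =
        (x.2.2 - x.1)⁻¹ • (slope c x.2.1 x.2.2 - slope c x.1 x.2.1 -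
          ((x.2.2 - x.1) / 2) • c₂) := by
      rw [smul_sub _ _ (((x.2.2 - x.1) / 2) • c₂), smul_smul]
      congr 2
      field_simp
    rw [e1, norm_smul, norm_inv, Real.norm_eq_abs, inv_mul_lt_iff₀ (abs_pos.2 hne')]
    nlinarith [abs_pos.2 hne']
  have hn : ‖c₁ s‖ ≠ 0 := norm_ne_zero_iff.2 h0
  have main := (((continuous_wedge e).tendsto (c₁ s, (1 / 2 : ℝ) • c₂)).comp
    (t01.prodMk_nhds tdd)).const_mul (2 * sigmaPlane e) |>.div
      ((t01.norm.mul t12.norm).mul t02.norm) (by positivity)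
  have elim : 2 * sigmaPlane e * wedge e (c₁ s) ((1 / 2 : ℝ) • c₂) / (‖c₁ s‖ * ‖c₁ s‖ * ‖c₁ s‖)
      = sigmaPlane e * wedge e (c₁ s) c₂ / ‖c₁ s‖ ^ 3 := by
    rw [wedge_smul_right]
    field_simp
  dsimp only at main
  rw [elim] at main
  refine main.congr' ?_
  filter_upwards [self_mem_nhdsWithin] with x hx
  have a1 : x.2.1 - x.1 ≠ 0 := sub_ne_zero.2 hx.1.symm
  have a2 : x.2.2 - x.2.1 ≠ 0 := sub_ne_zero.2 hx.2.1.symm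
  have a3 : x.2.2 - x.1 ≠ 0 := sub_ne_zero.2 hx.2.2.symm
  rw [turn_mul_curvatureQuotient]
  simp only [Pi.div_apply, Function.comp_apply]
  have hsm : ∀ p q, c q - c p = (q - p) • slope c p q := fun p q => (sub_smul_slope c p q).symm
  rw [hsm x.1 x.2.1, hsm x.2.1 x.2.2, hsm x.1 x.2.2, wedge_smul_smul, wedge_smul_right,
    wedge_sub_self, norm_smul, norm_smul, norm_smul]
  simp only [Real.norm_eq_abs]
  generalize slope c x.1 x.2.1 = A
  generalize slope c x.2.1 x.2.2 = B
  generalize slope c x.1 x.2.2 = C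
  generalize x.2.1 - x.1 = a at *
  generalize x.2.2 - x.2.1 = b at *
  generalize x.2.2 - x.1 = d at *
  have hP : a * b * d ≠ 0 := mul_ne_zero (mul_ne_zero a1 a2) a3
  have hsg : (SignType.sign (a * b * d) : ℝ) * |a * b * d|⁻¹ = (a * b * d)⁻¹ := by
    rcases hP.lt_or_gt with h | h
    · rw [sign_neg h, abs_of_neg h, inv_neg]; simp
    · rw [sign_pos h, abs_of_pos h]; simp
  calc _ = (a * b * d)⁻¹ * (a * b) * (2 * sigmaPlane e * wedge e A B) * (‖A‖ * ‖B‖ * ‖C‖)⁻¹ := by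
        rw [show (a * b * d)⁻¹ * (a * b) = d⁻¹ by field_simp]
        ring
    _ = _ := by
        rw [← hsg, abs_mul, abs_mul]
        simp only [div_eq_mul_inv, mul_inv]
        ring

theorem hasOrientedBusemannCurvature {c c₁ : ℝ → X} {c₂ : X} {s : ℝ}
    (h : ∀ᶠ t in 𝓝 s, HasDerivAt c (c₁ t) t) (h₂ : HasStrictDerivAt c₁ c₂ s) (h0 : c₁ s ≠ 0)
    (I : Set ℝ) {d : ℝ} (hd : d ≠ 0) : HasOrientedBusemannCurvature e c I s d
      (SignType.sign d * (sigmaPlane e * wedge e (c₁ s) c₂ / ‖c₁ s‖ ^ 3)) := by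
  have := ((tendsto_signed_curvature e h h₂ h0).mono_left (nhdsWithin_mono _
    (s := {x : ℝ × ℝ × ℝ | x.1 ∈ I ∧ x.2.1 ∈ I ∧ x.2.2 ∈ I ∧ 0 < d * (x.2.1 - x.1) ∧
      0 < d * (x.2.2 - x.2.1)}) fun x hx => ?_)).const_mul (SignType.sign d : ℝ)
  · refine this.congr' ?_
    filter_upwards [self_mem_nhdsWithin] with x hx
    -- Along the traversal all three increments have the sign of `d`, and so has their product.
    obtain ⟨-, -, -, h1, h2⟩ := hx
    rcases hd.lt_or_gt with hd | hd
    · have h1 := neg_of_mul_pos_right h1 hd.le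
      have h2 := neg_of_mul_pos_right h2 hd.le
      rw [sign_neg hd, sign_neg (mul_neg_of_pos_of_neg (mul_pos_of_neg_of_neg h1 h2)
        (by linarith))]
      simp
    · have h1 := pos_of_mul_pos_right h1 hd.le
      have h2 := pos_of_mul_pos_right h2 hd.le
      rw [sign_pos hd, sign_pos (mul_pos (mul_pos h1 h2) (by linarith))]
      simp
  · obtain ⟨-, -, -, h1, h2⟩ := hx
    have h3 : 0 < d * (x.2.2 - x.1) := by linarith
    exact ⟨fun h => by simp [h] at h1, fun h => by simp [h] at h2, fun h => by simp [h] at h3⟩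

theorem hasBusemannCurvature {c c₁ : ℝ → X} {c₂ : X} {s : ℝ}
    (h : ∀ᶠ t in 𝓝 s, HasDerivAt c (c₁ t) t) (h₂ : HasStrictDerivAt c₁ c₂ s) (h0 : c₁ s ≠ 0)
    (I : Set ℝ) : HasBusemannCurvature e c I s
      |sigmaPlane e * wedge e (c₁ s) c₂ / ‖c₁ s‖ ^ 3| := by
  refine ((tendsto_signed_curvature e h h₂ h0).abs.mono_left
    (nhdsWithin_mono _ fun x hx => hx.2.2.2)).congr' ?_
  filter_upwards [self_mem_nhdsWithin] with x hx
  obtain ⟨-, -, -, h1, h2, h3⟩ := hx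
  rw [abs_mul, abs_turn_mul_curvatureQuotient]
  have : (x.2.1 - x.1) * (x.2.2 - x.2.1) * (x.2.2 - x.1) ≠ 0 :=
    mul_ne_zero (mul_ne_zero (sub_ne_zero.2 h1.symm) (sub_ne_zero.2 h2.symm))
      (sub_ne_zero.2 h3.symm)
  rcases this.lt_or_gt with h | h
  · simp [sign_neg h]
  · simp [sign_pos h]

end Curvature

/-! ### Smoothness of the norm, of arc-length and of general rotations. -/

section Rotation

variable {X : Type*} [NormedAddCommGroup X] [NormedSpace ℝ X]

/-- The map `(t, r) ↦ r • c t` is a local C² diffeomorphism at `r = 1`, and near such a point the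
norm is the second coordinate of its inverse. Homogeneity extends this from the unit circle to all
nonzero points. -/
theorem contDiffAt_norm_of_unitCircleC2 (e : X ≃L[ℝ] ℂ) (hC2 : UnitCircleC2 X) {x : X}
    (hx : x ≠ 0) : ContDiffAt ℝ 2 (fun y : X => ‖y‖) x := by
  have : FiniteDimensional ℝ X := e.symm.toLinearEquiv.finiteDimensional
  obtain ⟨c, hc, hreg, hrange⟩ := hC2
  have hnorm : ∀ t, ‖c t‖ = 1 := fun t => by
    simpa using hrange.subset (mem_range_self t)
  have hsphere : ∀ z : X, ‖z‖ = 1 → ContDiffAt ℝ 2 (fun y : X => ‖y‖) z := by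
    intro z hz
    obtain ⟨t₀, rfl⟩ : z ∈ range c := hrange.superset (by simpa using hz)
    have hc' : ∀ t, HasDerivAt c (deriv c t) t := fun t =>
      (hc.differentiable (by norm_num) t).hasDerivAt
    let F : ℝ × ℝ → X := fun p => p.2 • c p.1
    have hF : ContDiff ℝ 2 F := contDiff_snd.smul (hc.comp contDiff_fst)
    let T : ℝ × ℝ →ₗ[ℝ] X :=
      (LinearMap.fst ℝ ℝ ℝ).smulRight (deriv c t₀) + (LinearMap.snd ℝ ℝ ℝ).smulRight (c t₀)
    have hT : ∀ p : ℝ × ℝ, T p = p.1 • deriv c t₀ + p.2 • c t₀ := fun p => rfl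
    have hinj : Function.Injective T := by
      rw [injective_iff_map_eq_zero]
      rintro ⟨a, b⟩ hab
      rw [hT] at hab
      have hct : ‖c t₀‖ ≠ 0 := by rw [hnorm]; exact one_ne_zero
      -- A functional supporting the unit disc at `c t₀` is maximal there along the curve, so it
      -- kills the tangent; thus tangent and radius are independent.
      obtain ⟨g, hg, hgc⟩ := exists_dual_vector ℝ (c t₀) hct
      have hgc' : g (c t₀) = 1 := by rw [hgc, hnorm]; simp
      have hmax : IsLocalMax (fun t => g (c t)) t₀ := Eventually.of_forall fun t => by
        have := (le_abs_self _).trans (g.le_opNorm (c t))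
        rw [hg, hnorm] at this
        simpa [hgc'] using this
      have hg0 : g (deriv c t₀) = 0 :=
        hmax.hasDerivAt_eq_zero (g.hasFDerivAt.comp_hasDerivAt t₀ (hc' t₀))
      have h1 := congrArg g hab
      simp only [map_add, map_smul, hg0, hgc', map_zero, smul_eq_mul, mul_zero, zero_add,
        mul_one] at h1
      rw [h1, zero_smul, add_zero, smul_eq_zero, or_iff_left (hreg t₀)] at hab
      simp only at hab
      simp [hab, h1]
    have hrank : Module.finrank ℝ (ℝ × ℝ) = Module.finrank ℝ X := by
      rw [e.toLinearEquiv.finrank_eq]; simp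
    let T' : (ℝ × ℝ) ≃L[ℝ] X :=
      (T.linearEquivOfInjective hinj hrank).toContinuousLinearEquiv
    have hder : HasFDerivAt F (T' : ℝ × ℝ →L[ℝ] X) (t₀, 1) := by
      have h1 : HasFDerivAt (fun p : ℝ × ℝ => c p.1) _ ((t₀, 1) : ℝ × ℝ) :=
        (hc' t₀).hasFDerivAt.comp ((t₀, 1) : ℝ × ℝ) hasFDerivAt_fst
      have h2 := (hasFDerivAt_snd (𝕜 := ℝ) (p := ((t₀, 1) : ℝ × ℝ))).smul h1
      refine HasFDerivAt.congr_fderiv (f := F) h2 (ContinuousLinearMap.ext fun p => ?_)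
      change _ = T p
      simp [hT]
    have hst := hF.contDiffAt.hasStrictFDerivAt' hder two_ne_zero
    have hG := hF.contDiffAt.to_localInverse hder two_ne_zero
    have hG0 : hst.localInverse F T' (t₀, 1) (F (t₀, 1)) = (t₀, 1) := hst.localInverse_apply_image
    have hFt : F (t₀, 1) = c t₀ := one_smul _ _
    rw [hFt] at hG hG0
    refine (contDiff_snd.contDiffAt.comp _ hG).congr_of_eventuallyEq ?_
    have h1 := hst.eventually_right_inverse
    have h2 : ∀ᶠ y in 𝓝 (c t₀), 0 < (hst.localInverse F T' (t₀, 1) y).2 := by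
      have := (continuous_snd.continuousAt.comp hG.continuousAt).tendsto
      refine this.eventually (lt_mem_nhds ?_)
      change 0 < (hst.localInverse F T' (t₀, 1) (c t₀)).2
      rw [hG0]; exact one_pos
    rw [hFt] at h1
    filter_upwards [h1, h2] with y hy1 hy2
    change ‖y‖ = (hst.localInverse F T' (t₀, 1) y).2
    conv_lhs => rw [← hy1]
    rw [norm_smul, hnorm, mul_one, Real.norm_eq_abs, abs_of_pos hy2]
  have hx' : ‖x‖ ≠ 0 := norm_ne_zero_iff.2 hx
  have h1 := hsphere (‖x‖⁻¹ • x) (by simp [norm_smul, hx'])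
  have h2 : ContDiffAt ℝ 2 (fun y : X => ‖x‖ * ‖‖x‖⁻¹ • y‖) x :=
    contDiffAt_const.mul (h1.comp x (contDiff_const_smul (‖x‖⁻¹)).contDiffAt)
  convert h2 using 2 with y
  rw [norm_smul, norm_inv, norm_norm, mul_inv_cancel_left₀ hx']

variable (e : X ≃L[ℝ] ℂ)

theorem symm_exp_ne_zero (θ : ℝ) : e.symm (Complex.exp (θ * Complex.I)) ≠ 0 := by
  simp [Complex.exp_ne_zero]

theorem norm_circlePoint (θ : ℝ) : ‖circlePoint e θ‖ = 1 := by
  rw [circlePoint, norm_smul, norm_inv, norm_norm,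
    inv_mul_cancel₀ (norm_ne_zero_iff.2 (symm_exp_ne_zero e θ))]

theorem apply_circlePoint (θ : ℝ) : e (circlePoint e θ) =
    (‖e.symm (Complex.exp (θ * Complex.I))‖⁻¹ : ℝ) * Complex.exp (θ * Complex.I) := by
  rw [circlePoint, map_smul, e.apply_symm_apply, Complex.real_smul]

theorem circlePoint_add_pi (θ : ℝ) : circlePoint e (θ + Real.pi) = -circlePoint e θ := by
  have : Complex.exp ((θ + Real.pi : ℝ) * Complex.I) = -Complex.exp (θ * Complex.I) := by
    rw [Complex.ofReal_add, add_mul, Complex.exp_add, Complex.exp_pi_mul_I, mul_neg_one]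
  rw [circlePoint, circlePoint, this, map_neg, norm_neg, smul_neg]

theorem circlePoint_periodic : Function.Periodic (circlePoint e) (2 * Real.pi) := fun θ => by
  rw [two_mul, ← add_assoc, circlePoint_add_pi, circlePoint_add_pi, neg_neg]

/-- A point is recovered from its norm and a polar angle. -/
theorem norm_smul_circlePoint {x : X} {r θ : ℝ} (hr : 0 ≤ r)
    (h : e x = r * Complex.exp (θ * Complex.I)) : ‖x‖ • circlePoint e θ = x := by
  have hx : x = r • e.symm (Complex.exp (θ * Complex.I)) := by
    rw [← map_smul, Complex.real_smul, ← h, e.symm_apply_apply]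
  rw [circlePoint]
  nth_rw 1 [hx]
  rw [norm_smul, smul_smul, Real.norm_eq_abs, abs_of_nonneg hr,
    mul_inv_cancel_right₀ (norm_ne_zero_iff.2 (symm_exp_ne_zero e θ)), ← hx]

theorem apply_eq_norm_mul_exp_arg (x : X) :
    e x = ‖e x‖ * Complex.exp ((e x).arg * Complex.I) :=
  (Complex.norm_mul_exp_arg_mul_I _).symm

section C2

theorem contDiff_circlePoint (hC2 : UnitCircleC2 X) : ContDiff ℝ 2 (circlePoint e) := by
  have hq : ContDiff ℝ 2 fun θ : ℝ => e.symm (Complex.exp (θ * Complex.I)) := by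
    refine e.symm.contDiff.comp (Complex.contDiff_exp.comp ?_)
    exact (Complex.ofRealCLM.contDiff).mul contDiff_const
  refine contDiff_iff_contDiffAt.2 fun θ => ?_
  have hn := (contDiffAt_norm_of_unitCircleC2 e hC2 (symm_exp_ne_zero e θ)).comp θ hq.contDiffAt
  exact (hn.inv (norm_ne_zero_iff.2 (symm_exp_ne_zero e θ))).smul hq.contDiffAt

theorem hasDerivAt_circlePoint (hC2 : UnitCircleC2 X) (θ : ℝ) :
    HasDerivAt (circlePoint e) (deriv (circlePoint e) θ) θ :=
  ((contDiff_circlePoint e hC2).differentiable two_ne_zero θ).hasDerivAt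

/-- Multiplying the circle point by `exp (-iθ)` gives its positive Euclidean radius ρ. A zero
derivative would make the derivative of this real function equal to `-iρ`, which has nonzero
imaginary part. -/
theorem deriv_circlePoint_ne_zero (hC2 : UnitCircleC2 X) (θ : ℝ) : deriv (circlePoint e) θ ≠ 0 := by
  intro h0
  have hu := hasDerivAt_circlePoint e hC2 θ
  rw [h0] at hu
  have h1 : HasDerivAt (fun θ : ℝ => e (circlePoint e θ) * Complex.exp (-(θ * Complex.I)))
      (e (circlePoint e θ) * (Complex.exp (-(θ * Complex.I)) * -Complex.I)) θ := by
    have h2 : HasDerivAt (fun θ : ℝ => e (circlePoint e θ)) (e 0) θ :=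
      e.hasFDerivAt.comp_hasDerivAt θ hu
    have h3 : HasDerivAt (fun θ : ℝ => Complex.exp (-(θ * Complex.I)))
        (Complex.exp (-(θ * Complex.I)) * -Complex.I) θ := by
      have := ((hasDerivAt_id θ).ofReal_comp.mul_const Complex.I).neg.cexp
      simpa using this
    refine (h2.mul h3).congr_deriv ?_
    rw [map_zero, zero_mul, zero_add]
  have h4 : (fun θ : ℝ => e (circlePoint e θ) * Complex.exp (-(θ * Complex.I))) =
      fun θ : ℝ => ((‖e.symm (Complex.exp (θ * Complex.I))‖⁻¹ : ℝ) : ℂ) := by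
    funext t
    rw [apply_circlePoint, mul_assoc, ← Complex.exp_add, add_neg_cancel, Complex.exp_zero, mul_one]
  have h5 := Complex.imCLM.hasFDerivAt.comp_hasDerivAt θ h1
  rw [h4] at h5
  have h6 : HasDerivAt (fun _ : ℝ => (0 : ℝ)) _ θ := h5
  have h7 := h6.unique (hasDerivAt_const θ 0)
  rw [← mul_assoc, congrFun h4 θ] at h7
  simp [Complex.exp_ne_zero] at h7

theorem hasStrictDerivAt_circleVariation (hC2 : UnitCircleC2 X) (θ : ℝ) :
    HasStrictDerivAt (variationOnFromTo (circlePoint e) univ 0) ‖deriv (circlePoint e) θ‖ θ := by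
  have hu := contDiff_circlePoint e hC2
  refine hasStrictDerivAt_variationOnFromTo ?_
    (hu.contDiffAt.hasStrictDerivAt two_ne_zero) 0
  intro a b _ _
  obtain ⟨K, hK⟩ := (hu.contDiffOn (s := Icc a b)).exists_lipschitzOnWith two_ne_zero
    (convex_Icc a b) isCompact_Icc
  rw [univ_inter]
  rcases le_total a b with hab | hab
  · have := hK.locallyBoundedVariationOn a b (left_mem_Icc.2 hab) (right_mem_Icc.2 hab)
    rwa [inter_self] at this
  · exact BoundedVariationOn.of_subsingleton (subsingleton_Icc_of_ge hab)

theorem circleVariation_pos (hC2 : UnitCircleC2 X) :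
    0 < variationOnFromTo (circlePoint e) univ 0 (2 * Real.pi) := by
  have : StrictMono (variationOnFromTo (circlePoint e) univ 0) :=
    strictMono_of_deriv_pos fun θ => by
      rw [(hasStrictDerivAt_circleVariation e hC2 θ).hasDerivAt.deriv]
      exact norm_pos_iff.2 (deriv_circlePoint_ne_zero e hC2 θ)
  have h := this Real.two_pi_pos
  rwa [variationOnFromTo.self] at h

theorem hasDerivAt_arcAngle (hC2 : UnitCircleC2 X) (θ : ℝ) : HasDerivAt (arcAngle e)
    (2 * Real.pi * ‖deriv (circlePoint e) θ‖ /
      variationOnFromTo (circlePoint e) univ 0 (2 * Real.pi)) θ :=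
  ((hasStrictDerivAt_circleVariation e hC2 θ).hasDerivAt.const_mul (2 * Real.pi)).div_const _

theorem deriv_arcAngle_pos (hC2 : UnitCircleC2 X) (θ : ℝ) : 0 < deriv (arcAngle e) θ := by
  rw [(hasDerivAt_arcAngle e hC2 θ).deriv]
  have := norm_pos_iff.2 (deriv_circlePoint_ne_zero e hC2 θ)
  have := circleVariation_pos e hC2
  positivity

/-- No derivative is lost: the density is the norm of a nowhere vanishing C¹ curve, and the norm is
smooth enough away from 0. -/
theorem contDiff_arcAngle (hC2 : UnitCircleC2 X) : ContDiff ℝ 2 (arcAngle e) := by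
  rw [show (2 : WithTop ℕ∞) = 1 + 1 by norm_num, contDiff_succ_iff_deriv]
  refine ⟨fun θ => (hasDerivAt_arcAngle e hC2 θ).differentiableAt, by simp, ?_⟩
  rw [show deriv (arcAngle e) = _ from funext fun θ => (hasDerivAt_arcAngle e hC2 θ).deriv]
  have h1 : ContDiff ℝ 1 (deriv (circlePoint e)) :=
    ((contDiff_succ_iff_deriv (n := 1)).1 (contDiff_circlePoint e hC2)).2.2
  refine (contDiff_const.mul (contDiff_iff_contDiffAt.2 fun θ => ?_)).div_const _
  exact ((contDiffAt_norm_of_unitCircleC2 e hC2 (deriv_circlePoint_ne_zero e hC2 θ)).of_le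
    (by norm_num)).comp θ h1.contDiffAt

/-- By central symmetry the density is π-periodic, so the increment over a half turn is constant;
two half turns give `2π` by the normalization. -/
theorem arcAngle_add_pi (hC2 : UnitCircleC2 X) (θ : ℝ) : arcAngle e (θ + Real.pi) = arcAngle e θ + Real.pi := by
  have hd : ∀ θ, HasDerivAt (fun t => arcAngle e (t + Real.pi) - arcAngle e t) 0 θ := fun θ => by
    have h1 := (hasDerivAt_arcAngle e hC2 (θ + Real.pi)).comp_add_const θ Real.pi
    refine (h1.sub (hasDerivAt_arcAngle e hC2 θ)).congr_deriv ?_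
    have : deriv (circlePoint e) (θ + Real.pi) = -deriv (circlePoint e) θ := by
      rw [← deriv_comp_add_const, ← deriv.fun_neg]
      congr 1
      exact funext (circlePoint_add_pi e)
    rw [this, norm_neg, sub_self]
  have hc := is_const_of_deriv_eq_zero (fun t => (hd t).differentiableAt) fun t => (hd t).deriv
  have h0 : arcAngle e 0 = 0 := by simp [arcAngle, variationOnFromTo.self]
  have h2 : arcAngle e (2 * Real.pi) = 2 * Real.pi :=
    mul_div_cancel_right₀ _ (circleVariation_pos e hC2).ne'
  have h3 := hc Real.pi 0
  have h4 := hc θ 0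
  simp only [zero_add, ← two_mul, h2, h0] at h3 h4
  linarith

theorem arcAngle_sub_self_periodic (hC2 : UnitCircleC2 X) :
    Function.Periodic (fun θ => arcAngle e θ - θ) Real.pi := fun θ => by
  simp only [arcAngle_add_pi e hC2]; ring

/-- All integer multiples of π are fixed, and the intermediate value theorem fills the gaps. -/
theorem arcAngle_surjective (hC2 : UnitCircleC2 X) : Function.Surjective (arcAngle e) := by
  have h0 : arcAngle e 0 = 0 := by simp [arcAngle, variationOnFromTo.self]
  have hn : ∀ n : ℤ, arcAngle e (n * Real.pi) = n * Real.pi := fun n => by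
    have := (arcAngle_sub_self_periodic e hC2).int_mul_eq n
    simp only [h0] at this
    linarith
  intro y
  refine mem_range_of_exists_le_of_exists_ge (contDiff_arcAngle e hC2).continuous
    ⟨⌊y / Real.pi⌋ * Real.pi, ?_⟩ ⟨⌈y / Real.pi⌉ * Real.pi, ?_⟩
  · rw [hn, ← le_div_iff₀ Real.pi_pos]; exact Int.floor_le _
  · rw [hn, ← div_le_iff₀ Real.pi_pos]; exact Int.le_ceil _

/-- The normalized arc-length of the unit circle as a homeomorphism of the line of angles. -/
noncomputable def arcHomeo (hC2 : UnitCircleC2 X) : ℝ ≃ₜ ℝ :=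
  ((strictMono_of_deriv_pos (deriv_arcAngle_pos e hC2)).orderIsoOfSurjective _
    (arcAngle_surjective e hC2)).toHomeomorph

theorem arcHomeo_apply (hC2 : UnitCircleC2 X) (θ : ℝ) : arcHomeo e hC2 θ = arcAngle e θ := rfl

theorem contDiff_arcHomeo (hC2 : UnitCircleC2 X) : ContDiff ℝ 2 (arcHomeo e hC2) := contDiff_arcAngle e hC2

theorem hasDerivAt_arcHomeo (hC2 : UnitCircleC2 X) (θ : ℝ) :
    HasDerivAt (arcHomeo e hC2) (deriv (arcAngle e) θ) θ :=
  (hasDerivAt_arcAngle e hC2 θ).differentiableAt.hasDerivAt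

theorem contDiff_arcHomeo_symm (hC2 : UnitCircleC2 X) : ContDiff ℝ 2 (arcHomeo e hC2).symm :=
  (arcHomeo e hC2).contDiff_symm_deriv (fun θ => (deriv_arcAngle_pos e hC2 θ).ne')
    (hasDerivAt_arcHomeo e hC2) (contDiff_arcHomeo e hC2)

theorem arcHomeo_add_int (hC2 : UnitCircleC2 X) (θ : ℝ) (n : ℤ) :
    arcHomeo e hC2 (θ + n * Real.pi) = arcHomeo e hC2 θ + n * Real.pi := by
  have := (arcAngle_sub_self_periodic e hC2).int_mul n θ
  simp only [arcHomeo_apply] at *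
  linarith

theorem arcHomeo_symm_add_int (hC2 : UnitCircleC2 X) (τ : ℝ) (n : ℤ) :
    (arcHomeo e hC2).symm (τ + n * Real.pi) = (arcHomeo e hC2).symm τ + n * Real.pi := by
  rw [Homeomorph.symm_apply_eq, arcHomeo_add_int, Homeomorph.apply_symm_apply]

theorem rot_eq_arg (hC2 : UnitCircleC2 X) (φ : ℝ) (x : X) : rot e φ x =
    ‖x‖ • circlePoint e ((arcHomeo e hC2).symm (arcHomeo e hC2 (e x).arg + φ)) := by
  have : Function.invFun (arcAngle e) = (arcHomeo e hC2).symm := by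
    funext y
    rw [← (arcHomeo e hC2).injective.eq_iff, Homeomorph.apply_symm_apply]
    exact Function.rightInverse_invFun (arcAngle_surjective e hC2) y
  rw [rot, this]
  rfl

theorem exists_int_of_polar_eq {r r' θ θ' : ℝ} (hr : 0 < r) (hr' : 0 < r')
    (h : (r : ℂ) * Complex.exp (θ * Complex.I) = r' * Complex.exp (θ' * Complex.I)) :
    ∃ n : ℤ, θ = θ' + (2 * n : ℤ) * Real.pi := by
  have hrr : r = r' := by
    have := congrArg norm h
    simpa [Complex.norm_exp_ofReal_mul_I, abs_of_pos hr, abs_of_pos hr'] using this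
  rw [hrr] at h
  obtain ⟨n, hn⟩ := Complex.exp_eq_exp_iff_exists_int.1
    (mul_left_cancel₀ (by exact_mod_cast hr'.ne') h)
  refine ⟨n, ?_⟩
  have h1 : (θ : ℂ) * Complex.I = ((θ' + (2 * n : ℤ) * Real.pi : ℝ) : ℂ) * Complex.I := by
    rw [hn]; push_cast; ring
  exact_mod_cast mul_right_cancel₀ Complex.I_ne_zero h1

theorem circlePoint_arcHomeo_symm_congr (hC2 : UnitCircleC2 X) {θ θ' : ℝ} {n : ℤ}
    (hθ : θ = θ' + (2 * n : ℤ) * Real.pi) (φ : ℝ) :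
    circlePoint e ((arcHomeo e hC2).symm (arcHomeo e hC2 θ + φ)) =
      circlePoint e ((arcHomeo e hC2).symm (arcHomeo e hC2 θ' + φ)) := by
  rw [hθ, arcHomeo_add_int, add_right_comm, arcHomeo_symm_add_int]
  have := (circlePoint_periodic e).int_mul n ((arcHomeo e hC2).symm (arcHomeo e hC2 θ' + φ))
  rw [← this]
  congr 1
  push_cast
  ring

/-- The general rotation in terms of an arbitrary polar angle. -/
theorem rot_eq (hC2 : UnitCircleC2 X) {x : X} {r θ : ℝ} (hr : 0 ≤ r) (h : e x = r * Complex.exp (θ * Complex.I)) (φ : ℝ) :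
    rot e φ x =
      ‖x‖ • circlePoint e ((arcHomeo e hC2).symm (arcHomeo e hC2 θ + φ)) := by
  rcases hr.eq_or_lt with rfl | hr
  · have : x = 0 := by simpa using h
    simp [rot, this]
  have hex : e x ≠ 0 := h ▸ mul_ne_zero (by exact_mod_cast hr.ne') (Complex.exp_ne_zero _)
  obtain ⟨n, hn⟩ := exists_int_of_polar_eq (norm_pos_iff.2 hex) hr
    ((apply_eq_norm_mul_exp_arg e x).symm.trans h)
  rw [rot_eq_arg e hC2, circlePoint_arcHomeo_symm_congr e hC2 hn]

theorem norm_rot (φ : ℝ) (x : X) : ‖rot e φ x‖ = ‖x‖ := by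
  rw [rot, norm_smul, norm_circlePoint, norm_norm, mul_one]

/-- Negative factors are included thanks to the central symmetry of the unit circle; they occur for
chords towards earlier points of a curve. -/
theorem rot_smul (hC2 : UnitCircleC2 X) (φ a : ℝ) (x : X) : rot e φ (a • x) = a • rot e φ x := by
  have h := apply_eq_norm_mul_exp_arg e x
  rw [rot_eq e hC2 (norm_nonneg _) h]
  rcases le_total 0 a with ha | ha
  · rw [rot_eq e hC2 (r := a * ‖e x‖) (θ := (e x).arg) (by positivity), norm_smul,
      Real.norm_eq_abs, abs_of_nonneg ha, mul_smul]
    rw [map_smul, Complex.real_smul, Complex.ofReal_mul, mul_assoc, ← h]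
  · rw [rot_eq e hC2 (r := -a * ‖e x‖) (θ := (e x).arg + Real.pi)
      (mul_nonneg (neg_nonneg.2 ha) (norm_nonneg _)), norm_smul,
      Real.norm_eq_abs, abs_of_nonpos ha]
    · have h1 := arcHomeo_add_int e hC2 (e x).arg 1
      have h2 := arcHomeo_symm_add_int e hC2 (arcHomeo e hC2 (e x).arg + φ) 1
      simp only [Int.cast_one, one_mul] at h1 h2
      rw [h1, add_right_comm, h2, circlePoint_add_pi, mul_smul, smul_neg, neg_smul, smul_neg,
        neg_neg]
    · rw [map_smul, Complex.real_smul, Complex.ofReal_add, add_mul, Complex.exp_add,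
        Complex.exp_pi_mul_I]
      nth_rw 1 [h]
      push_cast
      ring

/-- The Euclidean angle from `n` to `z`, in `(-π, π]`. -/
noncomputable def angleFrom (n z : X) : ℝ := (e z / e n).arg

theorem apply_eq_exp_angleFrom {n : X} (hn : n ≠ 0) (z : X) :
    e z = ‖e z‖ * Complex.exp (((e n).arg + angleFrom e n z : ℝ) * Complex.I) := by
  have hn' : e n ≠ 0 := by simpa using hn
  have h1 := apply_eq_norm_mul_exp_arg e n
  have h2 := (Complex.norm_mul_exp_arg_mul_I (e z / e n)).symm
  have h3 : (‖e n‖ : ℂ) ≠ 0 := by exact_mod_cast norm_ne_zero_iff.2 hn'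
  rw [div_eq_iff hn', norm_div] at h2
  rw [Complex.ofReal_add, add_mul, Complex.exp_add, angleFrom]
  generalize (e z / e n).arg = α at *
  generalize (e n).arg = ν at *
  generalize ‖e z‖ = r at *
  rw [h2]
  nth_rw 2 [h1]
  push_cast
  field_simp

theorem angleFrom_self {n : X} (hn : n ≠ 0) : angleFrom e n n = 0 := by
  have hn' : e n ≠ 0 := by simpa using hn
  rw [angleFrom, div_self hn', Complex.arg_one]

theorem contDiffAt_angleFrom {n : X} (hn : n ≠ 0) {k : WithTop ℕ∞} :
    ContDiffAt ℝ k (angleFrom e n) n := by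
  have hn' : e n ≠ 0 := by simpa using hn
  have h1 : ContDiffAt ℝ k (fun z => e z / e n) n := e.contDiff.contDiffAt.div_const _
  have h2 : ContDiffAt ℝ k Complex.log (e n / e n) :=
    (Complex.contDiffAt_log (by simp [div_self hn'])).restrict_scalars ℝ
  have h3 := Complex.imCLM.contDiff.contDiffAt.comp n (h2.comp n h1)
  exact h3.congr_of_eventuallyEq (Eventually.of_forall fun z => (Complex.log_im _).symm)

/-- The angle is the imaginary part of `log (z / n)`, and `log` has derivative 1 at 1. -/
theorem fderiv_angleFrom {n : X} (hn : n ≠ 0) (h : X) :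
    fderiv ℝ (angleFrom e n) n h = wedge e n h / ‖e n‖ ^ 2 := by
  have hn' : e n ≠ 0 := by simpa using hn
  have h1 : HasFDerivAt (fun z => e z * (e n)⁻¹) _ n := e.hasFDerivAt.mul_const (e n)⁻¹
  have h2 : HasFDerivAt Complex.log _ (e n * (e n)⁻¹) :=
    ((Complex.hasStrictDerivAt_log (x := e n * (e n)⁻¹)
      (by simp [mul_inv_cancel₀ hn'])).hasDerivAt.hasFDerivAt).restrictScalars ℝ
  have h3 := Complex.imCLM.hasFDerivAt.comp n (h2.comp n h1)
  have h4 : angleFrom e n = Complex.imCLM ∘ Complex.log ∘ fun z => e z * (e n)⁻¹ := by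
    funext z
    rw [angleFrom, ← Complex.log_im, div_eq_mul_inv]
    rfl
  rw [h4, h3.fderiv, wedge, ← Complex.normSq_eq_norm_sq]
  have h5 : starRingEnd ℂ (e n) * e h = ((Complex.normSq (e n) : ℝ) : ℂ) * ((e n)⁻¹ * e h) := by
    rw [Complex.normSq_eq_conj_mul_self]
    field_simp
  rw [h5, Complex.im_ofReal_mul, mul_div_cancel_left₀ _ (Complex.normSq_pos.2 hn').ne']
  simp [mul_inv_cancel₀ hn']

/-- Polar angles are measured from `x` itself, which keeps the branch cut of `arg` away from the
point considered. -/
theorem contDiffAt_rot (hC2 : UnitCircleC2 X) (φ : ℝ) {x : X} (hx : x ≠ 0) : ContDiffAt ℝ 2 (rot e φ) x := by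
  have h : rot e φ = fun z => ‖z‖ • circlePoint e ((arcHomeo e hC2).symm
      (arcHomeo e hC2 ((e x).arg + angleFrom e x z) + φ)) :=
    funext fun z => rot_eq e hC2 (norm_nonneg _) (apply_eq_exp_angleFrom e hx z) φ
  rw [h]
  refine (contDiffAt_norm_of_unitCircleC2 e hC2 hx).smul ?_
  refine (contDiff_circlePoint e hC2).contDiffAt.comp x ?_
  refine (contDiff_arcHomeo_symm e hC2).contDiffAt.comp x ?_
  refine ContDiffAt.add ((contDiff_arcHomeo e hC2).contDiffAt.comp x ?_) contDiffAt_const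
  exact contDiffAt_const.add (contDiffAt_angleFrom e hx)

end C2

end Rotation

/-! ### Images of chords under homogeneous maps. -/

section HomogeneousMaps

variable {E : Type*} [NormedAddCommGroup E] [NormedSpace ℝ E] {R : E → E}

/-- The differential of a map homogeneous of degree 1 is homogeneous of degree 0, so a chord may be
replaced by its divided difference. -/
theorem fderiv_smul_of_homogeneous (hR : ∀ (a : ℝ) x, R (a • x) = a • R x) {a : ℝ} (ha : a ≠ 0)
    {x : E} (hx : DifferentiableAt ℝ R (a • x)) : HasFDerivAt R (fderiv ℝ R (a • x)) x := by
  have h1 : HasFDerivAt (fun y : E => a • y) (a • ContinuousLinearMap.id ℝ E) x :=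
    (a • ContinuousLinearMap.id ℝ E).hasFDerivAt
  have h2 := (hx.hasFDerivAt.comp x h1).const_smul a⁻¹
  have h3 : (a⁻¹ • R ∘ fun y : E => a • y) = R := by
    funext y
    simp [hR, smul_smul, inv_mul_cancel₀ ha]
  rw [h3] at h2
  convert h2 using 1
  ext v
  simp [smul_smul, inv_mul_cancel₀ ha]

/-- Euler's identity for homogeneous maps. -/
theorem fderiv_apply_self_of_homogeneous (hR : ∀ (a : ℝ) x, R (a • x) = a • R x) {x : E}
    (hx : DifferentiableAt ℝ R x) : fderiv ℝ R x x = R x := by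
  have h1 : HasDerivAt (fun a : ℝ => a • x) x 1 := by
    simpa using (hasDerivAt_id (1 : ℝ)).smul_const x
  have h2 : HasDerivAt (fun a : ℝ => a • R x) (R x) 1 := by
    simpa using (hasDerivAt_id (1 : ℝ)).smul_const (R x)
  have h3 : HasFDerivAt R (fderiv ℝ R x) ((1 : ℝ) • x) := by
    rw [one_smul]; exact hx.hasFDerivAt
  have h4 := h3.comp_hasDerivAt (1 : ℝ) h1
  have h5 : (R ∘ fun a : ℝ => a • x) = fun a : ℝ => a • R x := funext fun a => hR a x
  rw [h5] at h4
  exact h4.unique h2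

/-- Differentiate Euler's identity: the product rule yields the first differential on both sides,
and what remains vanishes. -/
theorem fderiv_fderiv_apply_self_of_homogeneous (hR : ∀ (a : ℝ) x, R (a • x) = a • R x)
    {x : E} (hx : ContDiffAt ℝ 2 R x) (h : E) : fderiv ℝ (fderiv ℝ R) x h x = 0 := by
  have hd : ∀ᶠ y in 𝓝 x, DifferentiableAt ℝ R y :=
    (hx.eventually (by simp)).mono fun y hy => hy.differentiableAt two_ne_zero
  have h1 : HasFDerivAt (fderiv ℝ R) (fderiv ℝ (fderiv ℝ R) x) x :=
    ((hx.fderiv_right (m := 1) (by norm_num)).differentiableAt one_ne_zero).hasFDerivAt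
  have h2 := h1.clm_apply (hasFDerivAt_id x)
  have h3 : (fun y => fderiv ℝ R y (id y)) =ᶠ[𝓝 x] R :=
    hd.mono fun y hy => fderiv_apply_self_of_homogeneous hR hy
  have h4 := (h2.congr_of_eventuallyEq h3.symm).unique hd.self_of_nhds.hasFDerivAt
  have h5 := congrArg (fun L : E →L[ℝ] E => L h) h4
  simpa using h5

theorem eventually_hasDerivAt_deriv_of_contDiff_two {g : ℝ → E} (hg : ContDiff ℝ 2 g) (s : ℝ) :
    ∀ᶠ t in 𝓝 s, HasDerivAt g (deriv g t) t :=
  Eventually.of_forall fun t => (hg.differentiable two_ne_zero t).hasDerivAt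

theorem hasStrictDerivAt_deriv_of_contDiff_two {g : ℝ → E} (hg : ContDiff ℝ 2 g) (s : ℝ) :
    HasStrictDerivAt (deriv g) (deriv (deriv g) s) s :=
  (((contDiff_succ_iff_deriv (n := 1)).1 hg).2.2).contDiffAt.hasStrictDerivAt one_ne_zero

/-- A homogeneous map carries the chords of a curve from one of its points to a curve that has a
derivative near that point. -/
theorem eventually_hasDerivAt_homogeneous_chord (hR : ∀ (a : ℝ) x, R (a • x) = a • R x)
    (hR2 : ∀ x, x ≠ 0 → ContDiffAt ℝ 2 R x) {g : ℝ → E} (hg : ContDiff ℝ 2 g) {s : ℝ}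
    (hs : deriv g s ≠ 0) (p : E) :
    ∀ᶠ t in 𝓝 s, HasDerivAt (fun t => p + R (g t - g s))
      (fderiv ℝ R (dslope g s t) (deriv g t)) t := by
  have hw := hasStrictDerivAt_dslope (eventually_hasDerivAt_deriv_of_contDiff_two hg s)
    (hasStrictDerivAt_deriv_of_contDiff_two hg s)
  have hws : dslope g s s = deriv g s := dslope_same g s
  have hne : ∀ᶠ t in 𝓝 s, dslope g s t ≠ 0 := by
    refine hw.hasDerivAt.continuousAt.eventually_ne ?_
    rwa [hws]
  have hchord : ∀ t, g t - g s = (t - s) • dslope g s t := fun t => (sub_smul_dslope g s t).symm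
  filter_upwards [hne] with t ht
  refine HasDerivAt.const_add p ?_
  -- At `t = s` the chord is 0, where `R` need not be differentiable. There the factor `t - s` is
  -- pulled out of `R` and the product rule is used; elsewhere the chain rule applies.
  rcases eq_or_ne t s with rfl | hts
  · rw [hws, fderiv_apply_self_of_homogeneous hR ((hR2 _ hs).differentiableAt two_ne_zero)]
    have h1 : HasFDerivAt R (fderiv ℝ R (dslope g t t)) (dslope g t t) :=
      ((hR2 _ ht).differentiableAt two_ne_zero).hasFDerivAt
    have h2 := h1.comp_hasDerivAt t hw.hasDerivAt
    have h3 := ((hasDerivAt_id t).sub_const t).smul h2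
    have h4 : (fun u => R (g u - g t)) = (fun u => id u - t) • (R ∘ dslope g t) := by
      funext u
      rw [hchord, hR]
      rfl
    rw [h4]
    convert h3 using 1
    simp
  · have hts' : t - s ≠ 0 := sub_ne_zero.2 hts
    have hd : DifferentiableAt ℝ R ((t - s) • dslope g s t) :=
      (hR2 _ (smul_ne_zero hts' ht)).differentiableAt two_ne_zero
    have h1 := fderiv_smul_of_homogeneous hR hts' hd
    rw [h1.fderiv]
    have h2 := hd.hasFDerivAt
    rw [← hchord] at h2 ⊢
    exact h2.comp_hasDerivAt t
      (((hg.differentiable two_ne_zero t).hasDerivAt).sub_const (g s))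

/-- The product rule gives two terms; the one with the second differential of `R` is evaluated at
its own base point `deriv g s` and vanishes by Euler's identity. -/
theorem hasStrictDerivAt_homogeneous_chord (hR : ∀ (a : ℝ) x, R (a • x) = a • R x)
    (hR2 : ∀ x, x ≠ 0 → ContDiffAt ℝ 2 R x) {g : ℝ → E} (hg : ContDiff ℝ 2 g) {s : ℝ}
    (hs : deriv g s ≠ 0) :
    HasStrictDerivAt (fun t => fderiv ℝ R (dslope g s t) (deriv g t))
      (fderiv ℝ R (deriv g s) (deriv (deriv g) s)) s := by
  have hw := hasStrictDerivAt_dslope (eventually_hasDerivAt_deriv_of_contDiff_two hg s)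
    (hasStrictDerivAt_deriv_of_contDiff_two hg s)
  have hws : dslope g s s = deriv g s := dslope_same g s
  have h1 : HasStrictFDerivAt (fderiv ℝ R) (fderiv ℝ (fderiv ℝ R) (dslope g s s))
      (dslope g s s) := by
    rw [hws]
    exact ((hR2 _ hs).fderiv_right (m := 1) (by norm_num)).hasStrictFDerivAt one_ne_zero
  have h2 := (h1.comp_hasStrictDerivAt s hw).clm_apply (hasStrictDerivAt_deriv_of_contDiff_two hg s)
  refine h2.congr_deriv ?_
  rw [Function.comp_apply, hws, fderiv_fderiv_apply_self_of_homogeneous hR (hR2 _ hs), zero_add]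

end HomogeneousMaps

/-! ### From arc-length angle to Euclidean turning angle. -/

section Turning

variable {X : Type*} [NormedAddCommGroup X] [NormedSpace ℝ X] (e : X ≃L[ℝ] ℂ)

variable (hC2 : UnitCircleC2 X)

/-- The polar angle, counted from a direction with polar angle `θ`, of the general rotation of this
direction by the arc-length angle from `θ + b` to `θ + a`. -/
noncomputable def relativeTurn (θ a b : ℝ) : ℝ :=
  (arcHomeo e hC2).symm (arcHomeo e hC2 θ + (arcHomeo e hC2 (θ + a) - arcHomeo e hC2 (θ + b))) - θ

theorem relativeTurn_self (θ a : ℝ) : relativeTurn e hC2 θ a a = 0 := by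
  simp [relativeTurn]

/-- The density `k` of arc-length at `θ` enters through `arcHomeo` and cancels against `k⁻¹` from
its inverse, so the Euclidean rates simply subtract. -/
theorem hasDerivAt_relativeTurn {a b : ℝ → ℝ} {a' b' θ s : ℝ} (ha : HasDerivAt a a' s)
    (hb : HasDerivAt b b' s) (ha0 : a s = 0) (hb0 : b s = 0) :
    HasDerivAt (fun t => relativeTurn e hC2 θ (a t) (b t)) (a' - b') s := by
  set k := deriv (arcAngle e) θ with hk
  have hk0 : k ≠ 0 := (deriv_arcAngle_pos e hC2 θ).ne'
  have hA : HasDerivAt (arcHomeo e hC2) k θ := hasDerivAt_arcHomeo e hC2 θ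
  have hsymm : HasDerivAt (arcHomeo e hC2).symm k⁻¹ (arcHomeo e hC2 θ) := by
    refine HasDerivAt.of_local_left_inverse (arcHomeo e hC2).symm.continuous.continuousAt
      (f := arcHomeo e hC2) ?_ hk0 (Eventually.of_forall fun y => Homeomorph.apply_symm_apply _ _)
    rwa [Homeomorph.symm_apply_apply]
  have hcomp : ∀ {c : ℝ → ℝ} {c' : ℝ}, HasDerivAt c c' s → c s = 0 →
      HasDerivAt (fun t => arcHomeo e hC2 (θ + c t)) (k * c') s := fun {c c'} hc hc0 => by
    refine HasDerivAt.comp s (h₂ := arcHomeo e hC2) ?_ (hc.const_add θ)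
    rwa [hc0, add_zero]
  have h1 := ((hcomp ha ha0).sub (hcomp hb hb0)).const_add (arcHomeo e hC2 θ)
  have h2 : HasDerivAt (arcHomeo e hC2).symm k⁻¹ (arcHomeo e hC2 θ +
      ((fun t => arcHomeo e hC2 (θ + a t)) - fun t => arcHomeo e hC2 (θ + b t)) s) := by
    simpa [ha0, hb0] using hsymm
  refine ((h2.comp s h1).sub_const θ).congr_deriv ?_
  field_simp

/-- The Euclidean turning angle between two moments, expressed by the angles of the tangents. -/
theorem arg_rot_div_eq_relativeTurn {n x y : X} {φ : ℝ} (hn : n ≠ 0) (hx : x ≠ 0) (hy : y ≠ 0)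
    (hlt : |relativeTurn e hC2 (e n).arg (angleFrom e n x) (angleFrom e n (rot e φ y))|
      < Real.pi) :
    (e (rot e (dirAngle e y x - φ) n) / e n).arg =
      relativeTurn e hC2 (e n).arg (angleFrom e n x) (angleFrom e n (rot e φ y)) := by
  set θ := (e n).arg with hθ
  set κ := relativeTurn e hC2 θ (angleFrom e n x) (angleFrom e n (rot e φ y)) with hκ
  have pos : ∀ {z : X}, z ≠ 0 → 0 < ‖e z‖ := fun hz => norm_pos_iff.2 (by simpa using hz)
  have hr : rot e φ y ≠ 0 := by rw [← norm_ne_zero_iff, norm_rot]; exact norm_ne_zero_iff.2 hy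
  -- The definitions use principal arguments, which agree with the angles counted from `n` only
  -- modulo `2π`; `k₁` and `k₂` record the discrepancies, which disappear by periodicity.
  obtain ⟨k₁, h1⟩ := exists_int_of_polar_eq (pos hx) (pos hx)
    ((apply_eq_norm_mul_exp_arg e x).symm.trans (apply_eq_exp_angleFrom e hn x))
  have hpolar := rot_eq_arg e hC2 φ y
  have hcp : ∀ τ, 0 < ‖e.symm (Complex.exp ((τ : ℝ) * Complex.I))‖⁻¹ := fun τ =>
    inv_pos.2 (norm_pos_iff.2 (symm_exp_ne_zero e τ))
  obtain ⟨k₂, h2⟩ : ∃ k : ℤ, (arcHomeo e hC2).symm (arcHomeo e hC2 (e y).arg + φ) =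
      θ + angleFrom e n (rot e φ y) + (2 * k : ℤ) * Real.pi := by
    refine exists_int_of_polar_eq (mul_pos (norm_pos_iff.2 hy) (hcp ((arcHomeo e hC2).symm
      (arcHomeo e hC2 (e y).arg + φ)))) (pos hr)
      (Eq.trans ?_ (apply_eq_exp_angleFrom e hn (rot e φ y)))
    conv_rhs => rw [hpolar, map_smul, apply_circlePoint, Complex.real_smul]
    rw [Complex.ofReal_mul, mul_assoc]
  rw [Homeomorph.symm_apply_eq, arcHomeo_add_int] at h2
  have h3 : dirAngle e y x - φ = arcHomeo e hC2 (θ + angleFrom e n x) -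
      arcHomeo e hC2 (θ + angleFrom e n (rot e φ y)) + (2 * (k₁ - k₂) : ℤ) * Real.pi := by
    rw [dirAngle, ← arcHomeo_apply e hC2, ← arcHomeo_apply e hC2, h1, arcHomeo_add_int]
    push_cast at h2 ⊢
    linarith
  have h4 : (arcHomeo e hC2).symm (arcHomeo e hC2 θ + (dirAngle e y x - φ)) =
      θ + κ + (k₁ - k₂ : ℤ) * (2 * Real.pi) := by
    rw [h3, ← add_assoc, arcHomeo_symm_add_int, hκ, relativeTurn]
    push_cast
    ring
  rw [rot_eq_arg e hC2, h4, (circlePoint_periodic e).int_mul, map_smul, apply_circlePoint,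
    Complex.real_smul]
  have h0 := apply_eq_norm_mul_exp_arg e n
  rw [← hθ] at h0
  have h00 : ∀ z, z / e n = z / (‖e n‖ * Complex.exp (θ * Complex.I)) := fun z => by rw [← h0]
  have hρ0 := hcp (θ + κ)
  generalize ‖e.symm (Complex.exp ((θ + κ : ℝ) * Complex.I))‖⁻¹ = ρ at hρ0 ⊢
  rw [h00, Complex.ofReal_add, add_mul, Complex.exp_add]
  have h5 : (‖e n‖ : ℂ) ≠ 0 := by exact_mod_cast (pos hn).ne'
  have h6 : (‖n‖ : ℂ) * ((ρ : ℂ) * (Complex.exp (θ * Complex.I) * Complex.exp (κ * Complex.I))) /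
      (‖e n‖ * Complex.exp (θ * Complex.I)) =
      ((‖n‖ * ρ / ‖e n‖ : ℝ) : ℂ) * Complex.exp (κ * Complex.I) := by
    have := Complex.exp_ne_zero (θ * Complex.I)
    push_cast
    field_simp
  -- Since `κ` lies in `(-π, π)`, the principal argument is `κ` itself.
  have h7 := abs_lt.1 hlt
  rw [h6, Complex.arg_real_mul _ (div_pos (mul_pos (norm_pos_iff.2 hn) hρ0) (pos hn)),
    Complex.arg_exp_mul_I, (toIocMod_eq_self Real.two_pi_pos).2]
  exact ⟨h7.1, by linarith [h7.2]⟩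

theorem rot_dirAngle (hC2 : UnitCircleC2 X) {x y : X} (h : ‖y‖ = ‖x‖) : rot e (dirAngle e y x) y = x := by
  rw [rot_eq_arg e hC2, dirAngle, arcHomeo_apply, add_sub_cancel, ← arcHomeo_apply e hC2,
    Homeomorph.symm_apply_apply, h,
    norm_smul_circlePoint e (norm_nonneg _) (apply_eq_norm_mul_exp_arg e x)]

end Turning

/-! ### The rate of turning of the rolling motion. -/

section Rolling

variable {X : Type*} [NormedAddCommGroup X] [NormedSpace ℝ X] (e : X ≃L[ℝ] ℂ)

theorem HasOrientedBusemannCurvature.congr {c c' : ℝ → X} {I : Set ℝ} {s d χ : ℝ}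
    (h : HasOrientedBusemannCurvature e c I s d χ) (hcc : EqOn c c' I) :
    HasOrientedBusemannCurvature e c' I s d χ := by
  refine Tendsto.congr' ?_ h
  filter_upwards [self_mem_nhdsWithin] with x hx
  rw [hcc hx.1, hcc hx.2.1, hcc hx.2.2.1]

theorem HasBusemannCurvature.congr {c c' : ℝ → X} {I : Set ℝ} {s χ : ℝ}
    (h : HasBusemannCurvature e c I s χ) (hcc : EqOn c c' I) :
    HasBusemannCurvature e c' I s χ := by
  refine Tendsto.congr' ?_ h
  filter_upwards [self_mem_nhdsWithin] with x hx
  rw [hcc hx.1, hcc hx.2.1, hcc hx.2.2.1]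

/-- The rate of turning is the difference of the rates of rotation of the two tangents, after the
tangent of the moving polode has been carried to the tangent of the fixed one. -/
theorem turningRate_eq (hC2 : UnitCircleC2 X) {γ γ' : ℝ → X} {β s : ℝ} (hβ : 0 < β)
    (hs : s ∈ Icc 0 β) {x y : ℝ → X} {x' Y' : X}
    (hx : EqOn (derivWithin γ (Icc 0 β)) x (Icc 0 β))
    (hy : EqOn (derivWithin γ' (Icc 0 β)) y (Icc 0 β))
    (hx1 : ∀ t ∈ Icc 0 β, ‖x t‖ = 1) (hy1 : ∀ t ∈ Icc 0 β, ‖y t‖ = 1)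
    (hx' : HasDerivAt x x' s)
    (hY' : HasDerivAt (fun t => rot e (motionAngle e γ γ' β s) (y t)) Y' s) :
    turningRate e γ γ' β s =
      (wedge e (x s) x' - wedge e (x s) Y') / ‖e (x s)‖ ^ 2 := by
  have ne : ∀ {z : X}, ‖z‖ = 1 → z ≠ 0 := fun hz h0 => by simp [h0] at hz
  set n := x s with hn
  set φ := motionAngle e γ γ' β s with hφ
  have hφ' : φ = dirAngle e (y s) n := by rw [hφ, motionAngle, hx hs, hy hs]
  have hYs : rot e φ (y s) = n := by
    rw [hφ', rot_dirAngle e hC2 ((hy1 s hs).trans (hx1 s hs).symm)]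
  have hn0 : n ≠ 0 := ne (hx1 s hs)
  have hα : HasFDerivAt (angleFrom e n) (fderiv ℝ (angleFrom e n) n) n :=
    ((contDiffAt_angleFrom e hn0 (k := 1)).differentiableAt one_ne_zero).hasFDerivAt
  have hαY : HasFDerivAt (angleFrom e n) (fderiv ℝ (angleFrom e n) n) (rot e φ (y s)) := by
    rwa [hYs]
  have hκ := hasDerivAt_relativeTurn e hC2 (θ := (e n).arg) (hα.comp_hasDerivAt s hx')
    (hαY.comp_hasDerivAt s hY') (angleFrom_self e hn0)
    (by rw [Function.comp_apply, hYs, angleFrom_self e hn0])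
  rw [fderiv_angleFrom e hn0, fderiv_angleFrom e hn0, ← sub_div] at hκ
  -- The relative turn vanishes at `s` and is continuous there, so near `s` it stays within the
  -- range of the principal argument.
  have hsmall := hκ.continuousAt.abs.eventually_lt (continuousAt_const (y := Real.pi)) (by
    simp only [Function.comp_apply]
    rw [hYs, ← hn, relativeTurn_self, abs_zero]
    exact Real.pi_pos)
  have heq : turningAngle e γ γ' β s =ᶠ[𝓝[Icc 0 β] s] fun t => relativeTurn e hC2 (e n).arg
      ((angleFrom e n ∘ x) t) ((angleFrom e n ∘ fun t => rot e φ (y t)) t) := by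
    filter_upwards [nhdsWithin_le_nhds hsmall, self_mem_nhdsWithin] with t ht htI
    rw [turningAngle, ← hφ, hx hs, ← hn, motionAngle, hx htI, hy htI]
    exact arg_rot_div_eq_relativeTurn e hC2 hn0 (ne (hx1 t htI)) (ne (hy1 t htI)) ht
  rw [turningRate, heq.derivWithin_eq (heq.eq_of_nhdsWithin hs),
    hκ.hasDerivWithinAt.derivWithin (uniqueDiffOn_Icc hβ s hs)]

end Rolling

end NormedPlane

/-! ### The second Euler–Savary equation. -/

theorem mainTheorem1 {X : Type*} [NormedAddCommGroup X] [NormedSpace ℝ X] (e : X ≃L[ℝ] ℂ)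
    (hC2 : NormedPlane.UnitCircleC2 X)
    (γ γ' : ℝ → X) (β : ℝ) (hβ : 0 < β)
    (hγ : ContDiffOn ℝ 2 γ (Set.Icc 0 β)) (hγ' : ContDiffOn ℝ 2 γ' (Set.Icc 0 β))
    (hroll : NormedPlane.RollsWithoutSlipping γ' γ β)
    (s : ℝ) (hs : s ∈ Set.Icc 0 β)
    (hrot : NormedPlane.turningRate e γ γ' β s ≠ 0) :
    NormedPlane.movedPolode e γ γ' β s s = γ s ∧
    DifferentiableWithinAt ℝ (NormedPlane.movedPolode e γ γ' β s) (Set.Icc 0 β) s ∧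
    NormedPlane.polodeVelocity e γ γ' β (NormedPlane.movedPolode e γ γ' β s) s =
      NormedPlane.polodeVelocity e γ γ' β γ s ∧
    ∃ χ χ' : ℝ,
      NormedPlane.HasOrientedBusemannCurvature e γ (Set.Icc 0 β) s
        (NormedPlane.turningRate e γ γ' β s) χ ∧
      NormedPlane.HasBusemannCurvature e γ (Set.Icc 0 β) s |χ| ∧
      NormedPlane.HasOrientedBusemannCurvature e (NormedPlane.movedPolode e γ γ' β s)
        (Set.Icc 0 β) s (NormedPlane.turningRate e γ γ' β s) χ' ∧
      NormedPlane.HasBusemannCurvature e (NormedPlane.movedPolode e γ γ' β s)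
        (Set.Icc 0 β) s |χ'| ∧
      χ - χ' = 1 / NormedPlane.curvatureRadius χ - 1 / NormedPlane.curvatureRadius χ' ∧
      1 / NormedPlane.curvatureRadius χ - 1 / NormedPlane.curvatureRadius χ' =
        NormedPlane.sigmaPlane e /
          (NormedPlane.sigmaLine e (derivWithin γ (Set.Icc 0 β) s) ^ 2 *
            ‖NormedPlane.polodeVelocity e γ γ' β γ s‖) := by
  open NormedPlane Set Filter Topology in
  have : FiniteDimensional ℝ X := e.symm.toLinearEquiv.finiteDimensional
  have : CompleteSpace X := FiniteDimensional.complete ℝ X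
  -- Both polodes are extended to the whole line, so that two-sided derivatives exist also at `0`
  -- and `β`.
  obtain ⟨g, hg, hgγ⟩ := exists_contDiff_two_eqOn_Icc hβ hγ
  obtain ⟨g', hg', hgγ'⟩ := exists_contDiff_two_eqOn_Icc hβ hγ'
  have hu := uniqueDiffOn_Icc hβ
  have hderiv : ∀ {f c : ℝ → X}, ContDiff ℝ 2 f → EqOn f c (Icc 0 β) →
      EqOn (derivWithin c (Icc 0 β)) (deriv f) (Icc 0 β) := fun {f c} hf hfc t ht => by
    rw [← derivWithin_congr hfc (hfc ht)]
    exact (hf.differentiable two_ne_zero t).derivWithin (hu t ht)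
  have hspeed : ∀ {f c : ℝ → X}, ContDiff ℝ 2 f → EqOn f c (Icc 0 β) →
      HasUnitSpeedOn c (Icc 0 β) → ∀ t ∈ Icc 0 β, ‖deriv f t‖ = 1 := fun {f c} hf hfc hc t ht => by
    refine norm_eq_one_of_hasUnitSpeedOn hβ (fun p hp q hq => ?_) ht
      (hf.contDiffAt.hasStrictDerivAt two_ne_zero)
    rw [eVariationOn.congr (hfc.mono inter_subset_left)]
    exact hc hp hq
  have hx := hderiv hg hgγ
  have hy := hderiv hg' hgγ'
  have hx1 := hspeed hg hgγ hroll.arclength_fixed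
  have hy1 := hspeed hg' hgγ' hroll.arclength_moving
  have hxs : deriv g s ≠ 0 := fun h => by simpa [h] using hx1 s hs
  have hys : deriv g' s ≠ 0 := fun h => by simpa [h] using hy1 s hs
  set φ := motionAngle e γ γ' β s with hφ
  have hYs : rot e φ (deriv g' s) = deriv g s := by
    rw [hφ, motionAngle, hx hs, hy hs, rot_dirAngle e hC2 ((hy1 s hs).trans (hx1 s hs).symm)]
  have hR : ∀ (a : ℝ) z, rot e φ (a • z) = a • rot e φ z := rot_smul e hC2 φ
  have hR2 : ∀ z, z ≠ 0 → ContDiffAt ℝ 2 (rot e φ) z := fun z hz => contDiffAt_rot e hC2 φ hz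
  have hRs := (hR2 _ hys).differentiableAt two_ne_zero
  -- The moved polode, continued past the ends of the interval.
  set m : ℝ → X := fun t => γ s + rot e φ (g' t - g' s) with hm
  have hmp : EqOn m (movedPolode e γ γ' β s) (Icc 0 β) := fun t ht => by
    rw [hm, movedPolode, flexibleMotion, ← hφ, ← hgγ' hs, ← hgγ' ht]
  set m₁ : ℝ → X := fun t => fderiv ℝ (rot e φ) (dslope g' s t) (deriv g' t) with hm₁
  have hm1 : ∀ᶠ t in 𝓝 s, HasDerivAt m (m₁ t) t :=
    eventually_hasDerivAt_homogeneous_chord hR hR2 hg' hys (γ s)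
  have hm2 := hasStrictDerivAt_homogeneous_chord hR hR2 hg' hys
  set Y' := fderiv ℝ (rot e φ) (deriv g' s) (deriv (deriv g') s) with hY'
  have hm₁s : m₁ s = deriv g s := by
    rw [hm₁]
    simp only [dslope_same]
    rw [fderiv_apply_self_of_homogeneous hR hRs, hYs]
  have hg1 := eventually_hasDerivAt_deriv_of_contDiff_two hg s
  have hg2 := hasStrictDerivAt_deriv_of_contDiff_two hg s
  -- The carried tangent has as its derivative the same `Y'` that is the second derivative of `m`;
  -- this links the curvature to the rate of turning.
  have hYder : HasDerivAt (fun t => rot e φ (deriv g' t)) Y' s :=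
    hRs.hasFDerivAt.comp_hasDerivAt s (hasStrictDerivAt_deriv_of_contDiff_two hg' s).hasDerivAt
  have hrate := turningRate_eq e hC2 hβ hs hx hy hx1 hy1 hg2.hasDerivAt hYder
  have hmder : HasDerivWithinAt (movedPolode e γ γ' β s) (deriv g s) (Icc 0 β) s := by
    have h := hm1.self_of_nhds.hasDerivWithinAt (s := Icc 0 β)
    rw [hm₁s] at h
    exact h.congr (fun t ht => (hmp ht).symm) (hmp hs).symm
  have hmss : movedPolode e γ γ' β s s = γ s := by
    rw [← hmp hs, hm]
    simp [rot]
  have hchi := hasOrientedBusemannCurvature e hg1 hg2 hxs (Icc 0 β) hrot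
  have hchi' := hasOrientedBusemannCurvature e hm1 hm2 (hm₁s.trans_ne hxs) (Icc 0 β) hrot
  have habs := hasBusemannCurvature e hg1 hg2 hxs (Icc 0 β)
  have habs' := hasBusemannCurvature e hm1 hm2 (hm₁s.trans_ne hxs) (Icc 0 β)
  rw [hm₁s] at hchi' habs'
  set d := turningRate e γ γ' β s with hd
  have hsign : ∀ a : ℝ, |(SignType.sign d : ℝ) * a| = |a| := fun a => by
    rcases hrot.lt_or_gt with h | h
    · simp [sign_neg h]
    · simp [sign_pos h]
  refine ⟨hmss, hmder.differentiableWithinAt, ?_, _, _, hchi.congr e hgγ, ?_, hchi'.congr e hmp,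
    ?_, by simp [curvatureRadius], ?_⟩
  · rw [polodeVelocity, polodeVelocity, hmder.derivWithin (hu s hs), hx hs]
  · rw [hsign]; exact habs.congr e hgγ
  · rw [hsign]; exact habs'.congr e hmp
  · have hen : ‖e (deriv g s)‖ ≠ 0 := norm_ne_zero_iff.2 (by simpa using hxs)
    rw [polodeVelocity, hx hs, sigmaLine_eq e hxs, ← hd, norm_smul, hx1 s hs, norm_inv,
      Real.norm_eq_abs]
    rw [eq_div_iff (pow_ne_zero 2 hen)] at hrate
    -- The sign from the direction of traversal turns `d` into `|d|`, matching the reciprocal of the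
    -- length of the velocity vector.
    have hsd : (SignType.sign d : ℝ) * d = |d| := sign_mul_self d
    simp only [curvatureRadius, one_div, inv_inv, one_pow, div_one, mul_one]
    rw [← mul_sub, ← mul_sub, ← hrate]
    have hd0 : |d| ≠ 0 := abs_ne_zero.2 hrot
    field_simp
    rw [← hsd]
    ring
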